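/- Let $F$ be a finite field with $q$ elements, $E$ its quadratic extension, $N:E^\times\to F^\times$ the norm, and $G=\mathrm{GL}(2,F)$. Fix an $F$-basis of $E$ and let $K\cong E^\times$ be the Coxeter torus of $G$, consisting of the matrices $m_z$ of the maps $w\mapsto zw$ $(z\in E^\times)$. All characters take values in $\mathbb C^\times$. The irreducible complex representations $\pi^d_\Theta$ of $G$ ($d$ is the dimension) are, up to isomorphism, $\pi^1_{\alpha,\alpha}$ and $\pi^q_{\alpha,\alpha}$ for characters $\alpha$ of $F^\times$, $\pi^{q+1}_{\alpha,\beta}$ for characters $\alpha\ne\beta$ of $F^\times$, and the cuspidal $\pi^{q-1}_{\Lambda,\Lambda^q}$ for characters $\Lambda\neq\Lambda^q$ of $E^\times$; each of them exists, is irreducible, and is determined by the following values of its character at, respectively, $\begin{pmatrix}a&0\\0&a\end{pmatrix}$, $\begin{pmatrix}a&1\\0&a\end{pmatrix}$, $\begin{pmatrix}a&0\\0&d\end{pmatrix}$ with $a\ne d$, and $m_z$ with $z\in E\setminus F$ (where $a,d\in F^\times$): - $\pi^1_{\alpha,\alpha}$: $\alpha(a)^2,\ \alpha(a)^2,\ \alpha(a)\alpha(d),\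 \alpha(N z)$; - $\pi^q_{\alpha,\alpha}$: $q\,\alpha(a)^2,\ 0,\ \alpha(a)\alpha(d),\ -\alpha(N z)$; - $\pi^{q+1}_{\alpha,\beta}$: $(q+1)\alpha(a)\beta(a),\ \alpha(a)\beta(a),\ \alpha(a)\beta(d)+\alpha(d)\beta(a),\ 0$; - $\pi^{q-1}_{\Lambda,\Lambda^q}$: $(q-1)\Lambda(a),\ -\Lambda(a),\ 0,\ -(\Lambda(z)+\Lambda^q(z))$. Let $\Phi$ be any character of $E^\times\cong K$, let $\phi$ and $\lambda$ be the restrictions of $\Phi$ and $\Lambda$ to $F^\times$, and let $\delta_{x,y}$ be $1$ if $x=y$ and $0$ otherwise. Then the multiplicity $m_{\Theta,d}(\Phi)=\dim_{\mathbb C}\mathrm{Hom}_G(\pi^d_\Theta,\mathrm{Ind}_K^G\Phi)$ of $\pi^d_\Theta$ in $\mathrm{Ind}_K^G\Phi$ is - $\delta_{\alpha\circ N,\Phi}$ for $\pi^1_{\alpha,\alpha}$; - $\delta_{\alpha^2,\phi}-\delta_{\alpha\circ N,\Phi}$ for $\pi^q_{\alpha,\alpha}$; - $\delta_{\alpha\beta,\phi}$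 for $\pi^{q+1}_{\alpha,\beta}$ $(\alpha\neq\beta)$; - $\delta_{\lambda,\phi}-\delta_{\Lambda,\Phi}-\delta_{\Lambda^q,\Phi}$ for $\pi^{q-1}_{\Lambda,\Lambda^q}$ $(\Lambda\ne\Lambda^q)$. -/

import Mathlib

open Matrix

universe u v w

noncomputable section

namespace GL2Torus

/-- Kronecker's delta on an arbitrary type, with values in the integers. -/
def delta {X : Type*} (x y : X) : ℤ :=
  open Classical in if x = y then 1 else 0

section Rep

variable {G : Type*} [Group G]

/-- A multiplicative character, seen as a one-dimensional complex representation. -/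
def charRep (χ : G →* ℂˣ) : Representation ℂ G ℂ :=
  (Algebra.lmul ℂ ℂ : ℂ →* Module.End ℂ ℂ).comp ((Units.coeHom ℂ).comp χ)

theorem charRep_apply (χ : G →* ℂˣ) (g : G) (v : ℂ) : charRep χ g v = (χ g : ℂ) * v := rfl

/-- The multiplicity `dim Hom_G (π, σ)` of an irreducible representation `π` in `σ`. -/
def mult {V W : Type*} [AddCommGroup V] [Module ℂ V] [AddCommGroup W] [Module ℂ W]
    (π : Representation ℂ G V) (σ : Representation ℂ G W) : ℕ :=
  Module.finrank ℂ (π.IntertwiningMap σ)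

end Rep

section GL2

variable {F E : Type*} [Field F] [Field E] [Algebra F E]

/-- The embedding `z ↦ m_z` of `Eˣ` into `GL(2, F)`, where `m_z` is the matrix of `w ↦ z * w` in
the basis `b`. Its image is the Coxeter torus `K`. -/
def torusHom (b : Module.Basis (Fin 2) F E) : Eˣ →* GL (Fin 2) F :=
  Units.map (Algebra.leftMulMatrix b : E →* Matrix (Fin 2) (Fin 2) F)

theorem torusHom_injective (b : Module.Basis (Fin 2) F E) :
    Function.Injective (torusHom b) :=
  Units.map_injective (Algebra.leftMulMatrix_injective b)

/-- The representation of `GL(2, F)` induced from the character `Φ` of `K ≃ Eˣ`. -/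
abbrev indTorus (b : Module.Basis (Fin 2) F E) (Φ : Eˣ →* ℂˣ) :=
  Representation.ind (torusHom b) (charRep Φ)

/-- The matrix with rows `(a, x)` and `(0, d)`. -/
def upper (a d : Fˣ) (x : F) : GL (Fin 2) F :=
  Matrix.GeneralLinearGroup.mkOfDetNeZero !![(a : F), x; 0, (d : F)] (by simp)

/-- The restriction to `Fˣ` of a character of `Eˣ`. -/
def res (F : Type*) {E : Type*} [Field F] [Field E] [Algebra F E] (Φ : Eˣ →* ℂˣ) : Fˣ →* ℂˣ :=
  Φ.comp (Units.map (algebraMap F E : F →* E))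

/-- The character `α ∘ N` of `Eˣ`, where `N` is the norm from `E` to `F`. -/
def compNorm (E : Type*) {F : Type*} [Field F] [Field E] [Algebra F E] (α : Fˣ →* ℂˣ) :
    Eˣ →* ℂˣ :=
  α.comp (Units.map (Algebra.norm F : E →* F))

/-- The function `χ` takes the given values on the standard representatives of the four kinds of
conjugacy classes of `GL(2, F)`: scalar matrices, Jordan blocks, diagonal matrices with distinct
entries, and elliptic elements `m_z` with `z` outside `F`. Every element of `GL(2, F)` is
conjugate to one of these, so a class function is determined by these values. -/
structure HasValues (b : Module.Basis (Fin 2) F E) (χ : GL (Fin 2) F → ℂ)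
    (central jordan : Fˣ → ℂ) (split : Fˣ → Fˣ → ℂ) (elliptic : Eˣ → ℂ) : Prop where
  central_eq : ∀ a : Fˣ, χ (upper a a 0) = central a
  jordan_eq : ∀ a : Fˣ, χ (upper a a 1) = jordan a
  split_eq : ∀ a d : Fˣ, a ≠ d → χ (upper a d 0) = split a d
  elliptic_eq : ∀ z : Eˣ, (z : E) ∉ Set.range (algebraMap F E) → χ (torusHom b z) = elliptic z

variable {V : Type*} [AddCommGroup V] [Module ℂ V]

/-- `π` is (isomorphic to) the one-dimensional representation `π^1_{α,α}`. -/
structure IsOneDim (b : Module.Basis (Fin 2) F E) (α : Fˣ →* ℂˣ)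
    (π : Representation ℂ (GL (Fin 2) F) V) : Prop where
  irreducible : π.IsIrreducible
  values : HasValues b π.character (fun a => (α a : ℂ) ^ 2) (fun a => (α a : ℂ) ^ 2)
    (fun a d => (α a : ℂ) * (α d : ℂ)) (fun z => (compNorm E α z : ℂ))

/-- `π` is (isomorphic to) the Steinberg representation `π^q_{α,α}`. -/
structure IsSteinberg (b : Module.Basis (Fin 2) F E) (α : Fˣ →* ℂˣ)
    (π : Representation ℂ (GL (Fin 2) F) V) : Prop where
  irreducible : π.IsIrreducible
  values : HasValues b π.character (fun a => (Nat.card F : ℂ) * (α a : ℂ) ^ 2) (fun _ => 0)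
    (fun a d => (α a : ℂ) * (α d : ℂ)) (fun z => -(compNorm E α z : ℂ))

/-- `π` is (isomorphic to) the principal series representation `π^{q+1}_{α,β}`. -/
structure IsPrincipal (b : Module.Basis (Fin 2) F E) (α β : Fˣ →* ℂˣ)
    (π : Representation ℂ (GL (Fin 2) F) V) : Prop where
  irreducible : π.IsIrreducible
  values : HasValues b π.character (fun a => ((Nat.card F : ℂ) + 1) * ((α a : ℂ) * (β a : ℂ)))
    (fun a => (α a : ℂ) * (β a : ℂ))
    (fun a d => (α a : ℂ) * (β d : ℂ) + (α d : ℂ) * (β a : ℂ)) (fun _ => 0)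

/-- `π` is (isomorphic to) the cuspidal representation `π^{q-1}_Λ`. -/
structure IsCuspidal (b : Module.Basis (Fin 2) F E) (Λ : Eˣ →* ℂˣ)
    (π : Representation ℂ (GL (Fin 2) F) V) : Prop where
  irreducible : π.IsIrreducible
  values : HasValues b π.character (fun a => ((Nat.card F : ℂ) - 1) * (res F Λ a : ℂ))
    (fun a => -(res F Λ a : ℂ)) (fun _ _ => 0)
    (fun z => -((Λ z : ℂ) + ((Λ ^ Nat.card F) z : ℂ)))

end GL2

end GL2Torus

end

/-! The multiplicities come from Frobenius reciprocity (`indHomEquiv`, `mult_ind_eq`): the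
multiplicity of `π` in the induced representation is the mean over `Eˣ` of the character of `π` at
`m_z` times `Φ(z)⁻¹`. The torus meets only central and elliptic classes. Extending the formula for
the elliptic values to all of `Eˣ` and correcting on `Fˣ` (`natCard_mul_mult`) leaves sums of
characters over the abelian groups `Eˣ` and `Fˣ`, which orthogonality turns into Kronecker deltas.

The four families are constructed through virtual characters. The building blocks are `α ∘ det`, the
principal series `psFun α β` and the induced character `indFun b Λ`. The Steinberg character is
`psFun α α - detFun α`. The cuspidal one is `psFun 1 1 * psFun λ 1` minus twice `psFun λ 1` minus
`indFun b Λ`, with `λ` the restriction of `Λ` to `Fˣ`. The Weyl integration formula `sum_classFun`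
shows that each has norm one, and a difference of two characters that has norm one and nonnegative
degree is an irreducible character (`exists_isIrreducible_of_pairing_eq_one`).

For completeness, the regular character is a combination of the `psFun α β` and the `cuspFun b Λ`
(`pairing_regular`). An irreducible representation outside the families would be orthogonal to all
of these, so its degree would vanish. When `Λ = Λ ^ q`, the character `Λ` factors through the norm
as `α ∘ N`, and `cuspFun b Λ` is the Steinberg character minus `α ∘ det`. -/

noncomputable section

namespace GL2Torus

/-! ### Traces, characters and induction for general groups -/

section Rep

open Module Representation

/-- A linear splitting `i ∘ t + s ∘ p = id` need not commute with `TV`. Cyclicity of the trace still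
moves `t` and `p` to the left, where `h₁` and `h₂` apply. -/
theorem trace_eq_add_of_exact {k U V Q : Type*} [Field k] [AddCommGroup U] [Module k U]
    [FiniteDimensional k U] [AddCommGroup V] [Module k V] [FiniteDimensional k V]
    [AddCommGroup Q] [Module k Q] [FiniteDimensional k Q] {i : U →ₗ[k] V} {p : V →ₗ[k] Q}
    (hi : Function.Injective i) (hp : Function.Surjective p) (h : Function.Exact i p)
    {TU : U →ₗ[k] U} {TV : V →ₗ[k] V} {TQ : Q →ₗ[k] Q}
    (h₁ : TV ∘ₗ i = i ∘ₗ TU) (h₂ : p ∘ₗ TV = TQ ∘ₗ p) :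
    LinearMap.trace k V TV = LinearMap.trace k U TU + LinearMap.trace k Q TQ := by
  obtain ⟨s, hs⟩ := p.exists_rightInverse_of_surjective (LinearMap.range_eq_top.2 hp)
  obtain ⟨j, hj⟩ := i.exists_leftInverse_of_injective (LinearMap.ker_eq_bot.2 hi)
  have hs' : ∀ x, p (s x) = x := fun x => LinearMap.congr_fun hs x
  have hj' : ∀ x, j (i x) = x := fun x => LinearMap.congr_fun hj x
  have hpi : ∀ x, p (i x) = 0 := fun x => (h (i x)).2 ⟨x, rfl⟩
  set t : V →ₗ[k] U := j ∘ₗ (LinearMap.id - s ∘ₗ p) with ht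
  have hti : t ∘ₗ i = LinearMap.id := by
    ext x; simp [ht, hpi, hj']
  have hsum : i ∘ₗ t + s ∘ₗ p = LinearMap.id := by
    ext x
    obtain ⟨y, hy⟩ := (h (x - s (p x))).1 (by simp [hs'])
    have : i (t x) = x - s (p x) := by
      simp only [ht, LinearMap.comp_apply, LinearMap.sub_apply, LinearMap.id_apply, ← hy, hj']
    simp [this]
  calc LinearMap.trace k V TV = LinearMap.trace k V (TV ∘ₗ (i ∘ₗ t + s ∘ₗ p)) := by
        rw [hsum, LinearMap.comp_id]
    _ = LinearMap.trace k V ((TV ∘ₗ i) ∘ₗ t) + LinearMap.trace k V ((TV ∘ₗ s) ∘ₗ p) := by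
        rw [LinearMap.comp_add, map_add]; rfl
    _ = LinearMap.trace k U (t ∘ₗ (TV ∘ₗ i)) + LinearMap.trace k Q (p ∘ₗ (TV ∘ₗ s)) := by
        rw [LinearMap.trace_comp_comm' (TV ∘ₗ i) t, LinearMap.trace_comp_comm' (TV ∘ₗ s) p]
    _ = LinearMap.trace k U TU + LinearMap.trace k Q TQ := by
        rw [h₁, ← LinearMap.comp_assoc, hti, LinearMap.id_comp, ← LinearMap.comp_assoc, h₂,
          LinearMap.comp_assoc, hs, LinearMap.comp_id]

theorem trace_funLeft_equiv {k X : Type*} [Field k] [Fintype X] [DecidableEq X]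
    (σ : Equiv.Perm X) :
    LinearMap.trace k (X → k) (LinearMap.funLeft k k σ) =
      (Nat.card {x // σ x = x} : k) := by
  rw [LinearMap.trace_eq_matrix_trace k (Pi.basisFun k X), Matrix.trace, Nat.card_eq_fintype_card,
    Fintype.card_subtype, Finset.card_filter]
  push_cast
  refine Finset.sum_congr rfl fun x _ => ?_
  simp [LinearMap.funLeft_apply, Pi.single_apply]

section Finite

variable {G : Type*} [Group G]

theorem character_eq_add_of_exact {U V Q : Type*} [AddCommGroup U] [Module ℂ U]
    [FiniteDimensional ℂ U] [AddCommGroup V] [Module ℂ V] [FiniteDimensional ℂ V]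
    [AddCommGroup Q] [Module ℂ Q] [FiniteDimensional ℂ Q] {ρ : Representation ℂ G U}
    {σ : Representation ℂ G V} {τ : Representation ℂ G Q} (i : ρ.IntertwiningMap σ)
    (p : σ.IntertwiningMap τ) (hi : Function.Injective i) (hp : Function.Surjective p)
    (h : Function.Exact i p) : σ.character = ρ.character + τ.character := by
  ext g
  exact trace_eq_add_of_exact (i := i.toLinearMap) (p := p.toLinearMap) hi hp h
    (i.isIntertwining' g).symm (p.isIntertwining' g)

theorem character_prod {V W : Type*} [AddCommGroup V] [Module ℂ V]
    [FiniteDimensional ℂ V] [AddCommGroup W] [Module ℂ W] [FiniteDimensional ℂ W]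
    (ρ : Representation ℂ G V) (σ : Representation ℂ G W) :
    (ρ.prod σ).character = ρ.character + σ.character := by
  ext g
  exact LinearMap.trace_prodMap' (ρ g) (σ g)

theorem character_subrepresentation_add_quotient {V : Type*} [AddCommGroup V] [Module ℂ V]
    [FiniteDimensional ℂ V] (ρ : Representation ℂ G V) (S : Subrepresentation ρ) :
    ρ.character = S.toRepresentation.character +
      (ρ.quotient S.toSubmodule fun g _ hv => S.apply_mem_toSubmodule g hv).character := by
  refine character_eq_add_of_exact ⟨S.toSubmodule.subtype, fun g => ?_⟩
    ⟨S.toSubmodule.mkQ, fun g => ?_⟩ ?_ ?_ ?_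
  · rfl
  · rfl
  · exact S.toSubmodule.injective_subtype
  · exact S.toSubmodule.mkQ_surjective
  · exact LinearMap.exact_subtype_mkQ _

/-- The representation carried by a linear equivalence to another space. -/
def transport {V W : Type*} [AddCommGroup V] [Module ℂ V] [AddCommGroup W] [Module ℂ W]
    (ρ : Representation ℂ G V) (e : V ≃ₗ[ℂ] W) : Representation ℂ G W where
  toFun g := e.conj (ρ g)
  map_one' := by ext; simp [LinearEquiv.conj_apply]
  map_mul' g h := by ext; simp [LinearEquiv.conj_apply]

theorem transport_character {V W : Type*} [AddCommGroup V] [Module ℂ V] [AddCommGroup W]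
    [Module ℂ W] (ρ : Representation ℂ G V) (e : V ≃ₗ[ℂ] W) :
    (transport ρ e).character = ρ.character := by
  ext g
  exact LinearMap.trace_conj' (ρ g) e

/-- `f` is the character of a finite-dimensional complex representation of `G`. -/
def IsCharacter (f : G → ℂ) : Prop :=
  ∃ (n : ℕ) (ρ : Representation ℂ G (Fin n → ℂ)), ρ.character = f

/-- Coordinates bring a space from any universe to the model `Fin n → ℂ`, so later inductions can
stay in `Type`. -/
theorem isCharacter_character {V : Type*} [AddCommGroup V] [Module ℂ V] [FiniteDimensional ℂ V]
    (ρ : Representation ℂ G V) : IsCharacter ρ.character :=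
  ⟨_, transport ρ (finBasis ℂ V).equivFun, transport_character _ _⟩

theorem IsCharacter.add {f h : G → ℂ} (hf : IsCharacter f) (hh : IsCharacter h) :
    IsCharacter (f + h) := by
  obtain ⟨n, ρ, rfl⟩ := hf
  obtain ⟨m, σ, rfl⟩ := hh
  rw [← character_prod]
  exact isCharacter_character _

theorem IsCharacter.mul {f h : G → ℂ} (hf : IsCharacter f) (hh : IsCharacter h) :
    IsCharacter (f * h) := by
  obtain ⟨n, ρ, rfl⟩ := hf
  obtain ⟨m, σ, rfl⟩ := hh
  rw [← char_tensor]
  exact isCharacter_character _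

theorem charRep_character (χ : G →* ℂˣ) (g : G) : (charRep χ).character g = χ g := by
  have : charRep χ g = (χ g : ℂ) • LinearMap.id := by ext; simp [charRep_apply]
  rw [Representation.character, this, map_smul, LinearMap.trace_id]
  simp

theorem IsCharacter.apply_conj {f : G → ℂ} (hf : IsCharacter f) (g x : G) :
    f (x * g * x⁻¹) = f g := by
  obtain ⟨n, ρ, rfl⟩ := hf
  exact char_conj ρ g x

/-! ### Monomial representations on spaces of eigenfunctions -/

section Monomial

variable {A X : Type*} [Group A] [Fintype A] [Fintype X] 

/-- The functions on `X` on which the action `r` of `A` is through the inverse of `χ`. -/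
def eigenfunctions (r : A →* Equiv.Perm X) (χ : A →* ℂˣ) : Submodule ℂ (X → ℂ) where
  carrier := {f | ∀ a x, (χ a : ℂ) * f (r a x) = f x}
  add_mem' hf hg a x := by simp [mul_add, hf a x, hg a x]
  zero_mem' a x := by simp
  smul_mem' c f hf a x := by simp [mul_left_comm _ c, hf a x]

/-- The representation of `G` on the functions on `X` that are eigenfunctions for `A`. -/
def eigenRep (l : G →* Equiv.Perm X) (r : A →* Equiv.Perm X)
    (hlr : ∀ g a x, l g (r a x) = r a (l g x)) (χ : A →* ℂˣ) :
    Representation ℂ G (eigenfunctions r χ) where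
  toFun g := (LinearMap.funLeft ℂ ℂ (l g⁻¹)).restrict fun f hf a x => by
    simp only [LinearMap.funLeft_apply, hlr]; exact hf a _
  map_one' := by ext; simp [LinearMap.funLeft_apply]
  map_mul' g h := by ext; simp [LinearMap.funLeft_apply]

/-- The average `P` of the operators `χ(a) r(a)` projects onto the eigenfunctions, so the trace of
`g` there is the trace of `T ∘ P` on all functions. This is a combination of traces of permutation
operators, each of which counts fixed points. -/
theorem eigenRep_character (l : G →* Equiv.Perm X) (r : A →* Equiv.Perm X)
    (hlr : ∀ g a x, l g (r a x) = r a (l g x)) (χ : A →* ℂˣ) (g : G) :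
    (eigenRep l r hlr χ).character g =
      (Nat.card A : ℂ)⁻¹ * ∑ a, (χ a : ℂ) * (Nat.card {x // l g x = r a x} : ℂ) := by
  classical
  have hA : (Nat.card A : ℂ) ≠ 0 := by simp
  set P : (X → ℂ) →ₗ[ℂ] (X → ℂ) :=
    (Nat.card A : ℂ)⁻¹ • ∑ a, (χ a : ℂ) • LinearMap.funLeft ℂ ℂ (r a) with hP
  have hPapp : ∀ f x, P f x = (Nat.card A : ℂ)⁻¹ * ∑ a, (χ a : ℂ) * f (r a x) := by
    intro f x
    simp [hP, LinearMap.funLeft_apply, Finset.sum_apply]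
  have hPmem : ∀ f, P f ∈ eigenfunctions r χ := by
    intro f b x
    rw [hPapp, hPapp, mul_left_comm, Finset.mul_sum]
    congr 1
    rw [← Equiv.sum_comp (Equiv.mulRight b) fun a => (χ a : ℂ) * f (r a x)]
    refine Finset.sum_congr rfl fun a _ => ?_
    simp only [Equiv.coe_mulRight, map_mul, Units.val_mul, Equiv.Perm.mul_apply]
    ring
  have hPid : ∀ f ∈ eigenfunctions r χ, P f = f := by
    intro f hf
    ext x
    rw [hPapp, Finset.sum_congr rfl fun a _ => hf a x]
    simp
  set T := LinearMap.funLeft ℂ ℂ (l g⁻¹)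
  have hT : ∀ f ∈ eigenfunctions r χ, T f ∈ eigenfunctions r χ :=
    fun f hf => ((eigenRep l r hlr χ) g ⟨f, hf⟩).2
  have key := LinearMap.trace_restrict_eq_of_forall_mem (eigenfunctions r χ) (T ∘ₗ P)
    (fun f => hT _ (hPmem f))
  have hres : (T ∘ₗ P).restrict (fun f (_ : f ∈ eigenfunctions r χ) => hT _ (hPmem f)) =
      eigenRep l r hlr χ g := by
    ext f x
    exact congrFun (congrArg T (hPid f f.2)) x
  have hTP : T ∘ₗ P =
      (Nat.card A : ℂ)⁻¹ • ∑ a, (χ a : ℂ) • LinearMap.funLeft ℂ ℂ (r a * l g⁻¹) := by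
    ext f x
    simp [T, hP, LinearMap.funLeft_apply, Finset.sum_apply]
  rw [Representation.character, ← hres, key, hTP, map_smul, map_sum, smul_eq_mul]
  congr 1
  refine Finset.sum_congr rfl fun a _ => ?_
  rw [map_smul, trace_funLeft_equiv, smul_eq_mul]
  congr 2
  -- The substitution `y = l g⁻¹ x` turns fixed points of `r a * l g⁻¹` into solutions of `l g y = r
  -- a y`.
  refine Nat.card_congr ((l g⁻¹).subtypeEquiv fun x => ?_)
  rw [Equiv.Perm.mul_apply, ← Equiv.Perm.mul_apply (l g), ← map_mul, mul_inv_cancel, map_one,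
    Equiv.Perm.one_apply, eq_comm]

end Monomial

/-! ### The inner product and virtual characters of norm one -/

section InnerProduct

variable [Fintype G]

/-- The bilinear form `(f, h) ↦ |G|⁻¹ ∑ f(g) h(g⁻¹)` on functions on `G`. -/
def pairing (f h : G → ℂ) : ℂ := (Nat.card G : ℂ)⁻¹ * ∑ g, f g * h g⁻¹

theorem pairing_comm (f h : G → ℂ) : pairing f h = pairing h f := by
  unfold pairing
  rw [← Equiv.sum_comp (Equiv.inv G)]
  simp [mul_comm]

theorem pairing_add_left (f f' h : G → ℂ) : pairing (f + f') h = pairing f h + pairing f' h := by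
  simp [pairing, add_mul, Finset.sum_add_distrib, mul_add]

theorem pairing_sub_left (f f' h : G → ℂ) : pairing (f - f') h = pairing f h - pairing f' h := by
  simp [pairing, sub_mul, Finset.sum_sub_distrib, mul_sub]

theorem pairing_smul_left (c : ℂ) (f h : G → ℂ) : pairing (c • f) h = c * pairing f h := by
  simp [pairing, mul_assoc, Finset.mul_sum, mul_left_comm c]

theorem pairing_sum_left {ι : Type*} (s : Finset ι) (f : ι → G → ℂ) (h : G → ℂ) :
    pairing (∑ i ∈ s, f i) h = ∑ i ∈ s, pairing (f i) h := by
  simp only [pairing, Finset.sum_apply, Finset.sum_mul, Finset.mul_sum]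
  exact Finset.sum_comm

theorem pairing_add_right (f h h' : G → ℂ) : pairing f (h + h') = pairing f h + pairing f h' := by
  rw [pairing_comm, pairing_add_left, pairing_comm h, pairing_comm h']

theorem pairing_sub_right (f h h' : G → ℂ) : pairing f (h - h') = pairing f h - pairing f h' := by
  rw [pairing_comm, pairing_sub_left, pairing_comm h, pairing_comm h']

section

variable {V W : Type*} [AddCommGroup V] [Module ℂ V] [FiniteDimensional ℂ V]
  [AddCommGroup W] [Module ℂ W] [FiniteDimensional ℂ W]

theorem pairing_character (ρ : Representation ℂ G V) (σ : Representation ℂ G W) :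
    pairing σ.character ρ.character = finrank ℂ (ρ.IntertwiningMap σ) := by
  have : Invertible (Nat.card G : ℂ) := invertibleOfNonzero (by simp)
  exact card_inv_mul_sum_char_mul_char_eq_finrank ρ σ

omit [Fintype G] in
theorem one_le_finrank_intertwiningMap_self [Nontrivial V] (ρ : Representation ℂ G V) :
    1 ≤ finrank ℂ (ρ.IntertwiningMap ρ) := by
  have : Nontrivial (ρ.IntertwiningMap ρ) := by
    obtain ⟨v, hv⟩ := exists_ne (0 : V)
    refine ⟨⟨IntertwiningMap.id ρ, 0, fun h => hv ?_⟩⟩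
    simpa using congrArg (fun f : ρ.IntertwiningMap ρ => f v) h
  exact finrank_pos

/-- A complex representation of a finite group whose character has norm one is irreducible. -/
theorem isIrreducible_of_pairing_eq_one (ρ : Representation ℂ G V)
    (h : pairing ρ.character ρ.character = 1) : ρ.IsIrreducible := by
  have hV : Nontrivial V := by
    by_contra hV
    rw [not_nontrivial_iff_subsingleton] at hV
    have : Subsingleton (ρ.IntertwiningMap ρ) := ⟨fun a b => by ext x; exact Subsingleton.elim _ _⟩
    rw [pairing_character, finrank_zero_of_subsingleton] at h
    simp at h
  refine { exists_pair_ne := ⟨⊥, ⊤, fun hbt => ?_⟩, eq_bot_or_eq_top := fun S => ?_ }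
  · obtain ⟨v, hv⟩ := exists_ne (0 : V)
    have : v ∈ (⊥ : Subrepresentation ρ) := hbt ▸ (Submodule.mem_top : v ∈ (⊤ : Submodule ℂ V))
    exact hv ((Submodule.mem_bot ℂ).1 this)
  · by_contra! hS
    have h1 : Nontrivial S.toSubmodule := by
      rw [Submodule.nontrivial_iff_ne_bot]
      exact fun h => hS.1 (Subrepresentation.toSubmodule_injective h)
    have h2 : Nontrivial (V ⧸ S.toSubmodule) := by
      rw [Submodule.Quotient.nontrivial_iff]
      exact fun h => hS.2 (Subrepresentation.toSubmodule_injective h)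
    -- The two nonzero pieces contribute at least one each and the cross terms are nonnegative, so
    -- the norm would be at least two.
    rw [character_subrepresentation_add_quotient ρ S, pairing_add_left, pairing_add_right,
      pairing_add_right, pairing_character, pairing_character, pairing_character,
      pairing_character] at h
    have e1 := one_le_finrank_intertwiningMap_self S.toRepresentation
    have e2 := one_le_finrank_intertwiningMap_self
      (ρ.quotient S.toSubmodule fun g _ hv => S.apply_mem_toSubmodule g hv)
    norm_cast at h
    omega

theorem character_eq_of_pairing_ne_zero (ρ : Representation ℂ G V) (σ : Representation ℂ G W)
    [ρ.IsIrreducible] [σ.IsIrreducible] (h : pairing ρ.character σ.character ≠ 0) :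
    ρ.character = σ.character := by
  have : Invertible (Nat.card G : ℂ) := invertibleOfNonzero (by simp)
  have key := char_orthonormal ρ σ
  by_cases he : Nonempty (σ.Equiv ρ)
  · exact (char_iso he.some).symm
  · rw [if_neg he] at key
    exact absurd key h

end

/-- If a difference of two characters has norm one and nonnegative degree, it is a character. -/
theorem isCharacter_sub_of_pairing_eq_one_aux (n : ℕ) : ∀ (V W : Type) [AddCommGroup V]
    [Module ℂ V] [FiniteDimensional ℂ V] [AddCommGroup W] [Module ℂ W] [FiniteDimensional ℂ W]
    (ρ : Representation ℂ G V) (σ : Representation ℂ G W), finrank ℂ V ≤ n →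
    finrank ℂ W ≤ finrank ℂ V →
    pairing (ρ.character - σ.character) (ρ.character - σ.character) = 1 →
    IsCharacter (ρ.character - σ.character) := by
  induction n with
  | zero =>
    intro V W _ _ _ _ _ _ ρ σ hV hW h
    have hW0 : Subsingleton W := finrank_zero_iff.1 (by omega : finrank ℂ W = 0)
    have : σ.character = 0 := by
      ext g
      rw [Representation.character, Subsingleton.elim (σ g) 0, map_zero]; rfl
    rw [this, sub_zero]
    exact isCharacter_character ρ
  | succ n ih =>
    intro V W _ _ _ _ _ _ ρ σ hV hW h
    by_cases hT : ∃ T : ρ.IntertwiningMap σ, T ≠ 0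
    · obtain ⟨T, hT⟩ := hT
      -- The image of `T` is common to `ρ` and `σ`. Passing to the kernel and the cokernel of `T`
      -- cancels it, leaves the difference of characters unchanged and lowers both dimensions by the
      -- rank of `T`.
      have e1 : ρ.character = T.ker.toRepresentation.character +
          T.range.toRepresentation.character := by
        refine character_eq_add_of_exact ⟨T.ker.toSubmodule.subtype, fun g => rfl⟩
          ⟨T.toLinearMap.rangeRestrict, fun g => ?_⟩ ?_ ?_ ?_
        · ext v
          exact T.isIntertwining _ _ g v
        · exact T.ker.toSubmodule.injective_subtype
        · exact T.toLinearMap.surjective_rangeRestrict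
        · intro v
          change T.toLinearMap.rangeRestrict v = 0 ↔ v ∈ Set.range T.ker.toSubmodule.subtype
          rw [← Submodule.coe_eq_zero, Submodule.coe_subtype, Subtype.range_coe]
          exact Iff.rfl
      have e2 := character_subrepresentation_add_quotient σ T.range
      set Q := σ.quotient T.range.toSubmodule fun g _ hv => T.range.apply_mem_toSubmodule g hv
      have e3 : ρ.character - σ.character = T.ker.toRepresentation.character - Q.character := by
        rw [e1, e2]; abel
      have hlt : 0 < finrank ℂ T.range.toSubmodule := by
        have : Nontrivial T.range.toSubmodule := by
          rw [Submodule.nontrivial_iff_ne_bot]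
          intro hb
          exact hT (IntertwiningMap.ext (LinearMap.range_eq_bot.1 hb))
        exact finrank_pos
      have d1 := LinearMap.finrank_range_add_finrank_ker T.toLinearMap
      have d2 := Submodule.finrank_quotient_add_finrank T.range.toSubmodule
      change 0 < finrank ℂ (LinearMap.range T.toLinearMap) at hlt
      change finrank ℂ _ + finrank ℂ (LinearMap.range T.toLinearMap) = _ at d2
      have d3 : finrank ℂ T.ker.toSubmodule = finrank ℂ (LinearMap.ker T.toLinearMap) := rfl
      rw [e3] at h ⊢
      exact ih _ _ T.ker.toRepresentation Q (by omega) (by omega) h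
    -- Without common constituents the cross terms vanish, and the norm is at least two unless `σ`
    -- is zero.
    · push Not at hT
      by_cases hW0 : Nontrivial W
      · have hV0 : Nontrivial V := by
          have := finrank_pos (R := ℂ) (M := W)
          exact nontrivial_of_finrank_pos (R := ℂ) (by omega)
        have : Subsingleton (ρ.IntertwiningMap σ) := ⟨fun a b => by rw [hT a, hT b]⟩
        rw [pairing_sub_left, pairing_sub_right, pairing_sub_right,
          pairing_comm ρ.character σ.character, pairing_character, pairing_character,
          pairing_character, finrank_zero_of_subsingleton (M := ρ.IntertwiningMap σ)] at h
        have e1 := one_le_finrank_intertwiningMap_self ρ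
        have e2 := one_le_finrank_intertwiningMap_self σ
        simp only [Nat.cast_zero, sub_zero, zero_sub, sub_neg_eq_add] at h
        norm_cast at h
        omega
      · rw [not_nontrivial_iff_subsingleton] at hW0
        have : σ.character = 0 := by
          ext g
          rw [Representation.character, Subsingleton.elim (σ g) 0, map_zero]; rfl
        rw [this, sub_zero]
        exact isCharacter_character ρ

/-- If a difference of two characters has norm one and degree `d`, it is the character of an
irreducible representation of dimension `d`. -/
theorem exists_isIrreducible_of_pairing_eq_one {f h : G → ℂ} (hf : IsCharacter f)
    (hh : IsCharacter h) (hfh : pairing (f - h) (f - h) = 1) (d : ℕ) (hd : f 1 - h 1 = d) :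
    ∃ π : Representation ℂ G (Fin d → ℂ), π.IsIrreducible ∧ π.character = f - h := by
  obtain ⟨n, ρ, rfl⟩ := hf
  obtain ⟨m, σ, rfl⟩ := hh
  have hle : m ≤ n := by
    simp only [char_one, finrank_fin_fun] at hd
    have : (n : ℂ) = ((d + m : ℕ) : ℂ) := by push_cast; rw [← hd]; ring
    have := Nat.cast_injective this
    omega
  obtain ⟨k, π, hπ⟩ := isCharacter_sub_of_pairing_eq_one_aux n _ _ ρ σ (by simp) (by simpa) hfh
  obtain rfl : k = d := by
    have := congrFun hπ 1
    rw [Pi.sub_apply, hd, char_one, finrank_fin_fun] at this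
    exact_mod_cast this
  exact ⟨π, isIrreducible_of_pairing_eq_one π (hπ ▸ hfh), hπ⟩

end InnerProduct

/-! ### Frobenius reciprocity -/

section Frobenius

variable {H : Type*} [Group H] {V : Type*} [AddCommGroup V] [Module ℂ V]

/-- Frobenius reciprocity for maps out of an induced representation. -/
def indHomEquiv {A : Type*} [AddCommGroup A] [Module ℂ A] (φ : H →* G) (ρ : Representation ℂ H A)
    (π : Representation ℂ G V) :
    (ind φ ρ).IntertwiningMap π ≃ₗ[ℂ] ρ.IntertwiningMap (π.comp φ) where
  toFun f := ⟨f.toLinearMap ∘ₗ IndV.mk φ ρ 1, fun g => by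
    ext x
    have := (f.isIntertwining _ _ (φ g) (IndV.mk φ ρ 1 x))
    simp_all [← Coinvariants.mk_inv_tmul]⟩
  map_add' _ _ := rfl
  map_smul' _ _ := rfl
  -- `H` acts on the group algebra factor by left multiplication, so it is `π h⁻¹`, not `π h`, for
  -- which `h ⊗ x ↦ π h⁻¹ (f x)` descends to coinvariants.
  invFun f := ⟨Coinvariants.lift _
    (TensorProduct.lift <| (Finsupp.lift _ _ _ fun h => π h⁻¹ ∘ₗ f.toLinearMap) ∘ₗ
      (MonoidAlgebra.coeffLinearEquiv ℂ).toLinearMap)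
    fun g => by
      ext h x
      have := f.isIntertwining _ _ g x
      simp_all, fun g => by ext; simp⟩
  left_inv f := by
    ext h a
    have := f.isIntertwining _ _ h⁻¹ (IndV.mk φ ρ 1 a)
    simp_all
  right_inv f := by ext; simp

instance [Finite G] (φ : H →* G) (χ : H →* ℂˣ) : FiniteDimensional ℂ (IndV φ (charRep χ)) := by
  have : Module.Finite ℂ (MonoidAlgebra ℂ G) :=
    Module.Finite.equiv (MonoidAlgebra.coeffLinearEquiv ℂ).symm
  have : Module.Finite ℂ (TensorProduct ℂ (MonoidAlgebra ℂ G) ℂ) := inferInstance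
  exact Module.Finite.of_surjective _ (Coinvariants.mk_surjective
    (Representation.tprod ((leftRegular ℂ G).comp φ) (charRep χ)))

/-- The symmetry of `pairing` exchanges maps into the induced representation for maps out of it, to
which `indHomEquiv` applies. -/
theorem mult_ind_eq [Fintype G] [Fintype H] [FiniteDimensional ℂ V] (φ : H →* G) (χ : H →* ℂˣ)
    (π : Representation ℂ G V) :
    (mult π (ind φ (charRep χ)) : ℂ) =
      (Nat.card H : ℂ)⁻¹ * ∑ z, π.character (φ z) * (χ⁻¹ z : ℂˣ) := by
  rw [mult, ← pairing_character, pairing_comm, pairing_character,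
    (indHomEquiv φ (charRep χ) π).finrank_eq, ← pairing_character, pairing]
  congr 1
  refine Finset.sum_congr rfl fun z _ => ?_
  rw [charRep_character, map_inv, MonoidHom.inv_apply]
  rfl

end Frobenius

end Finite
end Rep

/-! ### Conjugacy in `GL(2, F)` -/

section Conj

variable {F : Type*} [Field F]

theorem upper_coe (a d : Fˣ) (x : F) :
    (upper a d x : Matrix (Fin 2) (Fin 2) F) = !![(a : F), x; 0, (d : F)] := rfl

@[simp] theorem upper_zero_zero (a d : Fˣ) (x : F) : upper a d x 0 0 = a := rfl
@[simp] theorem upper_zero_one (a d : Fˣ) (x : F) : upper a d x 0 1 = x := rfl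
@[simp] theorem upper_one_zero (a d : Fˣ) (x : F) : upper a d x 1 0 = 0 := rfl
@[simp] theorem upper_one_one (a d : Fˣ) (x : F) : upper a d x 1 1 = d := rfl

theorem upper_mul (a d a' d' : Fˣ) (x x' : F) :
    upper a d x * upper a' d' x' = upper (a * a') (d * d') (a * x' + x * d') := by
  ext i j
  fin_cases i <;> fin_cases j <;> simp [upper_coe, Matrix.mul_apply, Fin.sum_univ_two]

theorem upper_zero_inv (a d : Fˣ) : (upper a d 0)⁻¹ = upper a⁻¹ d⁻¹ 0 := by
  rw [inv_eq_iff_mul_eq_one, upper_mul]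
  ext i j
  fin_cases i <;> fin_cases j <;> simp

theorem upper_one_inv (a : Fˣ) :
    (upper a a 1)⁻¹ = upper a⁻¹ a⁻¹ (-((a⁻¹ * a⁻¹ : Fˣ) : F)) := by
  rw [inv_eq_iff_mul_eq_one, upper_mul]
  ext i j
  fin_cases i <;> fin_cases j <;> simp

/-- A matrix with zero off-diagonal entries and equal diagonal entries. -/
def IsScalar (g : GL (Fin 2) F) : Prop := g 0 1 = 0 ∧ g 1 0 = 0 ∧ g 0 0 = g 1 1

theorem IsScalar.exists_eq {g : GL (Fin 2) F} (h : IsScalar g) : ∃ a : Fˣ, g = upper a a 0 := by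
  have hdet : (g : Matrix (Fin 2) (Fin 2) F).det ≠ 0 := g.det_ne_zero
  rw [Matrix.det_fin_two, h.1, h.2.1] at hdet
  have h0 : g 0 0 ≠ 0 := by rintro h0; simp [h0] at hdet
  refine ⟨Units.mk0 _ h0, ?_⟩
  ext i j
  fin_cases i <;> fin_cases j <;> simp [h.1, h.2.1, h.2.2]

theorem isScalar_upper {a d : Fˣ} {x : F} : IsScalar (upper a d x) ↔ x = 0 ∧ a = d := by
  simp only [IsScalar, upper_zero_one, upper_one_zero, upper_zero_zero, upper_one_one, true_and]
  exact and_congr_right fun _ => Units.val_inj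

/-- The columns of `x` are `v` and `g v` for a vector `v` that is not an eigenvector. In this basis
`g` is the companion matrix, by Cayley–Hamilton. For nonscalar `g` one of `(1,0)`, `(0,1)`, `(1,1)`
will do. -/
theorem exists_mul_eq_mul_companion {g : GL (Fin 2) F} (h : ¬ IsScalar g) :
    ∃ x : GL (Fin 2) F, (g : Matrix (Fin 2) (Fin 2) F) * x =
      x * !![0, -(g : Matrix (Fin 2) (Fin 2) F).det; 1, (g : Matrix (Fin 2) (Fin 2) F).trace] := by
  have key : ∀ u v : F, u * (g 1 0 * u + g 1 1 * v) - (g 0 0 * u + g 0 1 * v) * v ≠ 0 →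
      ∃ x : GL (Fin 2) F, (g : Matrix (Fin 2) (Fin 2) F) * x = x *
      !![0, -(g : Matrix (Fin 2) (Fin 2) F).det; 1, (g : Matrix (Fin 2) (Fin 2) F).trace] := by
    intro u v huv
    refine ⟨GeneralLinearGroup.mkOfDetNeZero
      !![u, g 0 0 * u + g 0 1 * v; v, g 1 0 * u + g 1 1 * v] (by rwa [Matrix.det_fin_two_of]), ?_⟩
    ext i j
    fin_cases i <;> fin_cases j <;>
      simp [Matrix.mul_apply, Fin.sum_univ_two, Matrix.det_fin_two, Matrix.trace_fin_two,
        GeneralLinearGroup.mkOfDetNeZero] <;> ring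
  by_cases h10 : g 1 0 = 0
  · by_cases h01 : g 0 1 = 0
    · refine key 1 1 ?_
      have : g 0 0 ≠ g 1 1 := fun h' => h ⟨h01, h10, h'⟩
      simpa [h10, h01, sub_eq_zero] using this.symm
    · refine key 0 1 ?_
      simpa using h01
  · refine key 1 0 ?_
    simpa using h10

/-- Nonscalar matrices with the same trace and determinant are conjugate. -/
theorem isConj_of_trace_eq_of_det_eq {g h : GL (Fin 2) F} (hg : ¬ IsScalar g) (hh : ¬ IsScalar h)
    (htr : (g : Matrix (Fin 2) (Fin 2) F).trace = (h : Matrix (Fin 2) (Fin 2) F).trace)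
    (hdet : (g : Matrix (Fin 2) (Fin 2) F).det = (h : Matrix (Fin 2) (Fin 2) F).det) :
    IsConj g h := by
  obtain ⟨x, hx⟩ := exists_mul_eq_mul_companion hg
  obtain ⟨y, hy⟩ := exists_mul_eq_mul_companion hh
  rw [htr, hdet] at hx
  set C := !![0, -(h : Matrix (Fin 2) (Fin 2) F).det; 1, (h : Matrix (Fin 2) (Fin 2) F).trace]
  have hx' : ((x⁻¹ : GL (Fin 2) F) : Matrix (Fin 2) (Fin 2) F) * g = C * (x⁻¹ : GL (Fin 2) F) := by
    rw [Units.eq_mul_inv_iff_mul_eq, mul_assoc, hx, Units.inv_mul_cancel_left]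
  refine isConj_iff.2 ⟨y * x⁻¹, ?_⟩
  rw [mul_inv_eq_iff_eq_mul]
  refine Units.ext ?_
  simp only [Units.val_mul]
  rw [mul_assoc, hx', ← mul_assoc, ← hy, mul_assoc]

theorem IsScalar.eq_of_isConj {g h : GL (Fin 2) F} (hg : IsScalar g) (hgh : IsConj g h) :
    g = h := by
  obtain ⟨a, rfl⟩ := hg.exists_eq
  obtain ⟨c, rfl⟩ := isConj_iff.1 hgh
  rw [eq_mul_inv_iff_mul_eq]
  ext i j
  fin_cases i <;> fin_cases j <;>
    simp [upper_coe, Matrix.mul_apply, Fin.sum_univ_two, mul_comm]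

theorem isScalar_iff_of_isConj {g h : GL (Fin 2) F} (hgh : IsConj g h) :
    IsScalar g ↔ IsScalar h :=
  ⟨fun hg => hg.eq_of_isConj hgh ▸ hg, fun hh => hh.eq_of_isConj hgh.symm ▸ hh⟩

theorem trace_eq_of_isConj {g h : GL (Fin 2) F} (hgh : IsConj g h) :
    (g : Matrix (Fin 2) (Fin 2) F).trace = (h : Matrix (Fin 2) (Fin 2) F).trace := by
  obtain ⟨c, rfl⟩ := isConj_iff.1 hgh
  rw [Units.val_mul, Units.val_mul, Matrix.trace_mul_comm, Units.inv_mul_cancel_left]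

theorem det_eq_of_isConj {g h : GL (Fin 2) F} (hgh : IsConj g h) :
    (g : Matrix (Fin 2) (Fin 2) F).det = (h : Matrix (Fin 2) (Fin 2) F).det := by
  obtain ⟨c, rfl⟩ := isConj_iff.1 hgh
  rw [Units.val_mul, Units.val_mul, Matrix.det_mul_comm, Units.inv_mul_cancel_left]

theorem trace_upper (a d : Fˣ) (x : F) :
    (upper a d x : Matrix (Fin 2) (Fin 2) F).trace = a + d := by
  simp [upper_coe, Matrix.trace_fin_two]

theorem det_upper (a d : Fˣ) (x : F) :
    (upper a d x : Matrix (Fin 2) (Fin 2) F).det = a * d := by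
  simp [upper_coe, Matrix.det_fin_two]

theorem eq_or_eq_of_isConj_upper {a d a' d' : Fˣ} {x x' : F}
    (h : IsConj (upper a d x) (upper a' d' x')) : (a = a' ∧ d = d') ∨ (a = d' ∧ d = a') := by
  have htr := trace_eq_of_isConj h
  have hdet := det_eq_of_isConj h
  rw [trace_upper, trace_upper] at htr
  rw [det_upper, det_upper] at hdet
  have : ((a : F) - a') * (a - d') = 0 := by linear_combination (a : F) * htr - hdet
  rcases mul_eq_zero.1 this with h | h
  · rw [sub_eq_zero] at h
    exact Or.inl ⟨Units.ext h, Units.ext (by linear_combination htr - h)⟩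
  · rw [sub_eq_zero] at h
    exact Or.inr ⟨Units.ext h, Units.ext (by linear_combination htr - h)⟩

theorem isConj_upper_central {a c : Fˣ} : IsConj (upper a a 0) (upper c c 0) ↔ a = c := by
  refine ⟨fun h => ?_, fun h => h ▸ IsConj.refl _⟩
  rcases eq_or_eq_of_isConj_upper h with h | h <;> exact h.1

theorem isConj_upper_jordan {a c : Fˣ} : IsConj (upper a a 1) (upper c c 1) ↔ a = c := by
  refine ⟨fun h => ?_, fun h => h ▸ IsConj.refl _⟩
  rcases eq_or_eq_of_isConj_upper h with h | h <;> exact h.1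

theorem isConj_upper_split {a d a' d' : Fˣ} (h : a' ≠ d') :
    IsConj (upper a d 0) (upper a' d' 0) ↔ (a = a' ∧ d = d') ∨ (a = d' ∧ d = a') := by
  refine ⟨eq_or_eq_of_isConj_upper, ?_⟩
  rintro (⟨rfl, rfl⟩ | ⟨rfl, rfl⟩)
  · exact IsConj.refl _
  · refine isConj_of_trace_eq_of_det_eq ?_ ?_ ?_ ?_
    · simpa [isScalar_upper] using h.symm
    · simpa [isScalar_upper] using h
    · simp [trace_upper, add_comm]
    · simp [det_upper, mul_comm]

theorem isConj_upper_of_ne_zero (a : Fˣ) {x : F} (hx : x ≠ 0) :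
    IsConj (upper a a x) (upper a a 1) := by
  refine isConj_of_trace_eq_of_det_eq ?_ ?_ ?_ ?_
  · simp [isScalar_upper, hx]
  · simp [isScalar_upper]
  · simp [trace_upper]
  · simp [det_upper]

/-- A nonscalar `2 × 2` matrix has a cyclic vector, so its commutant is `F[r]`. Explicitly, `t` is
read off from a nonzero off-diagonal entry of `r`, or from the difference of the diagonal entries
when `r` is diagonal. -/
theorem exists_eq_smul_one_add_smul_of_commute {r x : GL (Fin 2) F} (hr : ¬ IsScalar r)
    (h : x * r = r * x) : ∃ s t : F, (x : Matrix (Fin 2) (Fin 2) F) =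
      s • (1 : Matrix (Fin 2) (Fin 2) F) + t • (r : Matrix (Fin 2) (Fin 2) F) := by
  have e : ∀ i j, (x : Matrix (Fin 2) (Fin 2) F) i 0 * r 0 j + x i 1 * r 1 j =
      r i 0 * x 0 j + r i 1 * x 1 j := by
    intro i j
    have := congrArg (fun y : GL (Fin 2) F => y i j) h
    simpa [Matrix.mul_apply, Fin.sum_univ_two] using this
  have e00 := e 0 0
  have e01 := e 0 1
  have e10 := e 1 0
  by_cases h10 : r 1 0 = 0
  · by_cases h01 : r 0 1 = 0
    · have hne : r 0 0 - r 1 1 ≠ 0 := fun h' => hr ⟨h01, h10, sub_eq_zero.1 h'⟩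
      rw [h01] at e01
      rw [h10] at e10
      have x01 : x 0 1 = 0 := by
        refine (mul_eq_zero.1 (?_ : x 0 1 * (r 0 0 - r 1 1) = 0)).resolve_right hne
        linear_combination -e01
      have x10 : x 1 0 = 0 := by
        refine (mul_eq_zero.1 (?_ : x 1 0 * (r 0 0 - r 1 1) = 0)).resolve_right hne
        linear_combination e10
      refine ⟨x 0 0 - (x 0 0 - x 1 1) / (r 0 0 - r 1 1) * r 0 0,
        (x 0 0 - x 1 1) / (r 0 0 - r 1 1), ?_⟩
      ext i j
      fin_cases i <;> fin_cases j <;> simp [x01, x10, h01, h10]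
      field_simp
      ring
    · refine ⟨x 0 0 - x 0 1 / r 0 1 * r 0 0, x 0 1 / r 0 1, ?_⟩
      ext i j
      fin_cases i <;> fin_cases j <;> simp <;> field_simp
      · linear_combination -e00
      · linear_combination -e01
  · refine ⟨x 0 0 - x 1 0 / r 1 0 * r 0 0, x 1 0 / r 1 0, ?_⟩
    ext i j
    fin_cases i <;> fin_cases j <;> simp <;> field_simp
    · linear_combination e00
    · linear_combination e10

/-! ### Orders of centralizers -/

section Centralizer

theorem card_centralizer_jordan (a : Fˣ) :
    Nat.card {x : GL (Fin 2) F // x * upper a a 1 = upper a a 1 * x} =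
      Nat.card F * Nat.card Fˣ := by
  rw [← Nat.card_prod]
  have hmem : ∀ p : F × Fˣ, upper p.2 p.2 p.1 * upper a a 1 = upper a a 1 * upper p.2 p.2 p.1 := by
    intro p
    rw [upper_mul, upper_mul]
    congr 1 <;> simp [mul_comm, add_comm]
  refine (Nat.card_congr (Equiv.ofBijective
    (fun p : F × Fˣ => ⟨upper p.2 p.2 p.1, hmem p⟩) ⟨?_, ?_⟩)).symm
  · rintro ⟨s, t⟩ ⟨s', t'⟩ h
    have h := congrArg Subtype.val h
    have h1 := congrArg (fun y : GL (Fin 2) F => y 0 1) h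
    have h2 := congrArg (fun y : GL (Fin 2) F => y 0 0) h
    simp only [upper_zero_zero, upper_zero_one] at h1 h2
    rw [h1, Units.ext h2]
  · rintro ⟨x, hx⟩
    obtain ⟨s, t, hst⟩ := exists_eq_smul_one_add_smul_of_commute
      (by simp [isScalar_upper]) hx
    have hs : s + t * a ≠ 0 := by
      intro h0
      have := x.det_ne_zero
      rw [hst, Matrix.det_fin_two] at this
      simp [upper_coe, h0] at this
    -- The matrix `s + t r` has upper right entry `t` and both diagonal entries equal to `s + t a`.
    refine ⟨(t, Units.mk0 _ hs), Subtype.ext (Units.ext ?_)⟩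
    rw [hst]
    ext i j
    fin_cases i <;> fin_cases j <;> simp [upper_coe]

theorem card_centralizer_split {a d : Fˣ} (h : a ≠ d) :
    Nat.card {x : GL (Fin 2) F // x * upper a d 0 = upper a d 0 * x} =
      Nat.card Fˣ * Nat.card Fˣ := by
  rw [← Nat.card_prod]
  have hmem : ∀ p : Fˣ × Fˣ, upper p.1 p.2 0 * upper a d 0 = upper a d 0 * upper p.1 p.2 0 := by
    intro p
    rw [upper_mul, upper_mul]
    congr 1 <;> simp [mul_comm]
  refine (Nat.card_congr (Equiv.ofBijective
    (fun p : Fˣ × Fˣ => ⟨upper p.1 p.2 0, hmem p⟩) ⟨?_, ?_⟩)).symm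
  · rintro ⟨s, t⟩ ⟨s', t'⟩ h
    have h := congrArg Subtype.val h
    have h1 := congrArg (fun y : GL (Fin 2) F => y 0 0) h
    have h2 := congrArg (fun y : GL (Fin 2) F => y 1 1) h
    simp only [upper_zero_zero, upper_one_one] at h1 h2
    rw [Units.ext h1, Units.ext h2]
  · rintro ⟨x, hx⟩
    obtain ⟨s, t, hst⟩ := exists_eq_smul_one_add_smul_of_commute
      (by simpa [isScalar_upper] using h) hx
    have hs : (s + t * a) * (s + t * d) ≠ 0 := by
      have := x.det_ne_zero
      rw [hst, Matrix.det_fin_two] at this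
      simpa [upper_coe] using this
    refine ⟨(Units.mk0 _ (left_ne_zero_of_mul hs), Units.mk0 _ (right_ne_zero_of_mul hs)),
      Subtype.ext (Units.ext ?_)⟩
    rw [hst]
    ext i j
    fin_cases i <;> fin_cases j <;> simp [upper_coe]

end Centralizer

/-! ### The Coxeter torus and elliptic classes -/

section Torus

variable {E : Type*} [Field E] [Algebra F E] (b : Module.Basis (Fin 2) F E)

theorem torusHom_coe (z : Eˣ) :
    (torusHom b z : Matrix (Fin 2) (Fin 2) F) = Algebra.leftMulMatrix b (z : E) := rfl

/-- The embedding of `Fˣ` into `Eˣ`. -/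
abbrev unitsEmb (F E : Type*) [Field F] [Field E] [Algebra F E] : Fˣ →* Eˣ :=
  Units.map (algebraMap F E : F →* E)

theorem torusHom_unitsEmb (a : Fˣ) : torusHom b (unitsEmb F E a) = upper a a 0 := by
  refine Units.ext ?_
  rw [torusHom_coe, upper_coe, Units.coe_map, MonoidHom.coe_coe, AlgHom.commutes,
    Matrix.algebraMap_eq_diagonal]
  ext i j
  fin_cases i <;> fin_cases j <;> simp

theorem isScalar_torusHom {z : Eˣ} :
    IsScalar (torusHom b z) ↔ (z : E) ∈ Set.range (algebraMap F E) := by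
  constructor
  · intro h
    obtain ⟨a, ha⟩ := h.exists_eq
    rw [← torusHom_unitsEmb b] at ha
    rw [torusHom_injective b ha]
    exact ⟨a, rfl⟩
  · rintro ⟨a, ha⟩
    have ha0 : a ≠ 0 := by rintro rfl; exact z.ne_zero (by rw [← ha, map_zero])
    have : z = unitsEmb F E (Units.mk0 a ha0) := Units.ext ha.symm
    rw [this, torusHom_unitsEmb, isScalar_upper]
    simp

/-- Cayley–Hamilton for `m_z`, pulled back along the injection of `E` into matrices. -/
theorem sq_eq_trace_mul_sub_det (z : Eˣ) :
    (z : E) ^ 2 = algebraMap F E (torusHom b z : Matrix (Fin 2) (Fin 2) F).trace * z -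
      algebraMap F E (torusHom b z : Matrix (Fin 2) (Fin 2) F).det := by
  apply Algebra.leftMulMatrix_injective b
  rw [map_pow, map_sub, map_mul, AlgHom.commutes, AlgHom.commutes, torusHom_coe]
  generalize Algebra.leftMulMatrix b (z : E) = M
  rw [Matrix.algebraMap_eq_diagonal, Matrix.algebraMap_eq_diagonal, sq]
  ext i j
  fin_cases i <;> fin_cases j <;>
    simp [Matrix.mul_apply, Fin.sum_univ_two, Matrix.trace_fin_two, Matrix.det_fin_two] <;> ring

/-- For `z` outside `F` the elements `1` and `z` are independent over `F`, so the quadratic equation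
of `z` has unique coefficients. -/
theorem trace_det_eq_of_sq_eq {z : Eˣ} (hz : (z : E) ∉ Set.range (algebraMap F E)) {t n : F}
    (h : (z : E) ^ 2 = algebraMap F E t * z - algebraMap F E n) :
    (torusHom b z : Matrix (Fin 2) (Fin 2) F).trace = t ∧
      (torusHom b z : Matrix (Fin 2) (Fin 2) F).det = n := by
  have h' := sq_eq_trace_mul_sub_det b z
  set T := (torusHom b z : Matrix (Fin 2) (Fin 2) F).trace
  set N := (torusHom b z : Matrix (Fin 2) (Fin 2) F).det
  have e : algebraMap F E (T - t) * z = algebraMap F E (N - n) := by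
    rw [map_sub, map_sub]; linear_combination h - h'
  have hT : T = t := by
    by_contra hne
    have hne' : algebraMap F E (T - t) ≠ 0 := by
      rw [map_ne_zero]; exact sub_ne_zero.2 hne
    exact hz ⟨(N - n) / (T - t), by rw [map_div₀, ← e, mul_div_cancel_left₀ _ hne']⟩
  refine ⟨hT, ?_⟩
  rw [hT, sub_self, map_zero, zero_mul] at e
  exact sub_eq_zero.1 ((map_eq_zero _).1 e.symm)

/-- The commutant `F[m_w]` is the image of the field `E`, so its invertible elements form the torus
itself. -/
theorem card_centralizer_elliptic {w : Eˣ} (hw : (w : E) ∉ Set.range (algebraMap F E)) :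
    Nat.card {x : GL (Fin 2) F // x * torusHom b w = torusHom b w * x} = Nat.card Eˣ := by
  have hmem : ∀ z : Eˣ, torusHom b z * torusHom b w = torusHom b w * torusHom b z := by
    intro z
    rw [← map_mul, ← map_mul, mul_comm]
  refine (Nat.card_congr (Equiv.ofBijective (fun z : Eˣ => ⟨torusHom b z, hmem z⟩)
    ⟨?_, ?_⟩)).symm
  · intro z z' h
    exact torusHom_injective b (congrArg Subtype.val h)
  · rintro ⟨x, hx⟩
    obtain ⟨s, t, hst⟩ := exists_eq_smul_one_add_smul_of_commute
      (by rwa [isScalar_torusHom]) hx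
    have hx' : (x : Matrix (Fin 2) (Fin 2) F) =
        Algebra.leftMulMatrix b (s • (1 : E) + t • (w : E)) := by
      rw [hst, map_add, map_smul, map_smul, map_one, torusHom_coe]
    have h0 : s • (1 : E) + t • (w : E) ≠ 0 := by
      intro h0
      rw [h0, map_zero] at hx'
      exact x.ne_zero hx'
    exact ⟨Units.mk0 _ h0, Subtype.ext (Units.ext hx'.symm)⟩

section Finite

variable [Finite F]

/-- The elements of `F` already supply `q` roots of `X ^ q - X`, which has no more than `q` roots in
`E`. -/
theorem pow_card_eq_self_iff {x : E} :
    x ^ Nat.card F = x ↔ x ∈ Set.range (algebraMap F E) := by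
  classical
  have := Fintype.ofFinite F
  rw [Nat.card_eq_fintype_card]
  constructor
  · intro hx
    have h1 := Fintype.one_lt_card (α := F)
    have hne := FiniteField.X_pow_card_sub_X_ne_zero E h1
    set p : Polynomial E := Polynomial.X ^ Fintype.card F - Polynomial.X
    have hroot : ∀ y, y ∈ p.roots.toFinset ↔ y ^ Fintype.card F = y := by
      intro y
      rw [Multiset.mem_toFinset, Polynomial.mem_roots hne, Polynomial.IsRoot.def]
      simp [p, sub_eq_zero]
    have hsub : Finset.univ.image (algebraMap F E) ⊆ p.roots.toFinset := by
      intro y hy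
      obtain ⟨a, -, rfl⟩ := Finset.mem_image.1 hy
      rw [hroot, ← map_pow, FiniteField.pow_card]
    have hcard : p.roots.toFinset.card ≤ (Finset.univ.image (algebraMap F E)).card := by
      rw [Finset.card_image_of_injective _ (algebraMap F E).injective, Finset.card_univ]
      refine (Multiset.toFinset_card_le _).trans ((Polynomial.card_roots' p).trans ?_)
      exact (FiniteField.X_pow_card_sub_X_natDegree_eq E h1).le
    have := Finset.eq_of_subset_of_card_le hsub hcard
    have hx' := (hroot x).2 hx
    rw [← this] at hx'
    obtain ⟨a, -, ha⟩ := Finset.mem_image.1 hx'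
    exact ⟨a, ha⟩
  · rintro ⟨a, rfl⟩
    rw [← map_pow, FiniteField.pow_card]

omit [Finite F] in
include b in
theorem natCard_ext : Nat.card E = Nat.card F ^ 2 := by
  have := Module.Finite.of_basis b
  have := Module.natCard_eq_pow_finrank (K := F) (V := E)
  rwa [Module.finrank_eq_card_basis b, Fintype.card_fin] at this

include b in
theorem pow_card_pow_card (x : E) : (x ^ Nat.card F) ^ Nat.card F = x := by
  have := Module.Finite.of_basis b
  have : Finite E := Module.finite_of_finite F
  have := Fintype.ofFinite E
  rw [← pow_mul, ← sq, ← natCard_ext b, Nat.card_eq_fintype_card, FiniteField.pow_card]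

theorem pow_card_add_mul (x y : E) (a : F) : (algebraMap F E a * x - y) ^ Nat.card F =
    algebraMap F E a * x ^ Nat.card F - y ^ Nat.card F := by
  have := Fintype.ofFinite F
  rw [Nat.card_eq_fintype_card]
  have h := fun x => congrFun (FiniteField.coe_frobeniusAlgHom F E) x
  simp only [← h]
  rw [map_sub, map_mul, AlgHom.commutes]

include b in
theorem pow_card_mem_range_iff {x : E} :
    x ^ Nat.card F ∈ Set.range (algebraMap F E) ↔ x ∈ Set.range (algebraMap F E) := by
  rw [← pow_card_eq_self_iff, ← pow_card_eq_self_iff, pow_card_pow_card b, eq_comm]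

/-- Conjugacy amounts to equality of the quadratic equations over `F`, and the equation of `w` has
exactly the roots `w` and `w ^ q`. -/
theorem isConj_torusHom {z w : Eˣ} (hw : (w : E) ∉ Set.range (algebraMap F E)) :
    IsConj (torusHom b z) (torusHom b w) ↔ z = w ∨ z = w ^ Nat.card F := by
  have hsq := sq_eq_trace_mul_sub_det b w
  have hsq' : ((w ^ Nat.card F : Eˣ) : E) ^ 2 =
      algebraMap F E (torusHom b w : Matrix (Fin 2) (Fin 2) F).trace * (w ^ Nat.card F : Eˣ) -
      algebraMap F E (torusHom b w : Matrix (Fin 2) (Fin 2) F).det := by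
    have h := congrArg (· ^ Nat.card F) hsq
    simp only [pow_card_add_mul] at h
    rw [pow_card_eq_self_iff.2 ⟨_, rfl⟩, ← pow_mul, mul_comm 2, pow_mul] at h
    simpa using h
  have hw' : ((w ^ Nat.card F : Eˣ) : E) ∉ Set.range (algebraMap F E) := by
    rwa [Units.val_pow_eq_pow_val, pow_card_mem_range_iff b]
  constructor
  · intro h
    have hz := sq_eq_trace_mul_sub_det b z
    rw [trace_eq_of_isConj h, det_eq_of_isConj h] at hz
    have hne : (w : E) - (w ^ Nat.card F : Eˣ) ≠ 0 := by
      rw [sub_ne_zero, Units.val_pow_eq_pow_val]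
      exact fun h => hw (pow_card_eq_self_iff.1 h.symm)
    set T := algebraMap F E (torusHom b w : Matrix (Fin 2) (Fin 2) F).trace
    -- Subtracting the equations of `w` and of its Frobenius conjugate, which differs from `w`,
    -- identifies the trace as their sum.
    have hT : T = w + (w ^ Nat.card F : Eˣ) := by
      apply mul_left_cancel₀ hne
      linear_combination hsq' - hsq
    have : ((z : E) - w) * (z - (w ^ Nat.card F : Eˣ)) = 0 := by
      linear_combination hz - hsq + (z - w : E) * hT
    rcases mul_eq_zero.1 this with h | h
    · exact Or.inl (Units.ext (sub_eq_zero.1 h))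
    · exact Or.inr (Units.ext (sub_eq_zero.1 h))
  · rintro (rfl | rfl)
    · exact IsConj.refl _
    · obtain ⟨h1, h2⟩ := trace_det_eq_of_sq_eq b hw' hsq'
      exact isConj_of_trace_eq_of_det_eq (by rwa [isScalar_torusHom]) (by rwa [isScalar_torusHom])
        h1 h2

/-- Every element of `GL(2, F)` is conjugate to a scalar matrix, a Jordan block, a diagonal
matrix or an element of the Coxeter torus. -/
theorem exists_isConj_normalForm (g : GL (Fin 2) F) :
    (∃ a : Fˣ, g = upper a a 0) ∨ (∃ a : Fˣ, IsConj g (upper a a 1)) ∨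
    (∃ a d : Fˣ, a ≠ d ∧ IsConj g (upper a d 0)) ∨
    (∃ z : Eˣ, (z : E) ∉ Set.range (algebraMap F E) ∧ IsConj g (torusHom b z)) := by
  by_cases hg : IsScalar g
  · exact Or.inl hg.exists_eq
  right
  set t := (g : Matrix (Fin 2) (Fin 2) F).trace with ht
  set n := (g : Matrix (Fin 2) (Fin 2) F).det with hn
  have hn0 : n ≠ 0 := g.det_ne_zero
  by_cases hroot : ∃ a : F, a ^ 2 - t * a + n = 0
  · obtain ⟨a, ha⟩ := hroot
    have had : a * (t - a) = n := by linear_combination -ha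
    have ha0 : a ≠ 0 := by rintro rfl; exact hn0 (by simpa using had.symm)
    have hd0 : t - a ≠ 0 := by intro h; exact hn0 (by simpa [h] using had.symm)
    by_cases hne : a = t - a
    · refine Or.inl ⟨Units.mk0 a ha0, isConj_of_trace_eq_of_det_eq hg ?_ ?_ ?_⟩
      · simp [isScalar_upper]
      · rw [trace_upper, Units.val_mk0]; linear_combination -hne
      · rw [det_upper, Units.val_mk0]; linear_combination -had - a * hne
    · refine Or.inr (Or.inl ⟨Units.mk0 a ha0, Units.mk0 _ hd0, ?_,
        isConj_of_trace_eq_of_det_eq hg ?_ ?_ ?_⟩)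
      · exact fun h => hne (congrArg Units.val h)
      · rw [isScalar_upper]
        exact fun h => hne (congrArg Units.val h.2)
      · rw [trace_upper, Units.val_mk0, Units.val_mk0]; ring
      · rw [det_upper, Units.val_mk0, Units.val_mk0]; exact had.symm
  · right; right
    push Not at hroot
    open Polynomial in
    obtain ⟨z, hz⟩ : ∃ z : E, z ^ 2 - algebraMap F E t * z + algebraMap F E n = 0 := by
      set p : F[X] := X ^ 2 - C t * X + C n with hp
      have hdeg : p.natDegree = 2 := by rw [hp]; compute_degree!
      have hirr : Irreducible p := by
        refine Polynomial.irreducible_of_degree_le_three_of_not_isRoot ?_ ?_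
        · rw [hdeg]; decide
        · intro a ha
          exact hroot a (by simpa [hp] using ha)
      have : Fact (Irreducible p) := ⟨hirr⟩
      have hfr : Module.finrank F (AdjoinRoot p) = 2 := by
        rw [(AdjoinRoot.powerBasis hirr.ne_zero).finrank, AdjoinRoot.powerBasis_dim, hdeg]
      have : Module.Finite F (AdjoinRoot p) := (AdjoinRoot.powerBasis hirr.ne_zero).finite
      have : Module.Finite F E := Module.Finite.of_basis b
      have : Finite E := Module.finite_of_finite F
      -- The characteristic polynomial is irreducible here. Its root field has degree two over `F`,
      -- hence embeds in `E`, which therefore contains a root.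
      obtain ⟨f⟩ := FiniteField.nonempty_algHom_of_finrank_dvd (F := F) (K := AdjoinRoot p)
        (L := E) (by rw [hfr, Module.finrank_eq_card_basis b, Fintype.card_fin])
      refine ⟨f (AdjoinRoot.root p), ?_⟩
      have key : aeval (f (AdjoinRoot.root p)) p = 0 := by
        rw [aeval_algHom_apply, AdjoinRoot.aeval_eq, AdjoinRoot.mk_self, map_zero]
      generalize f (AdjoinRoot.root p) = y at key ⊢
      rw [hp] at key
      simpa using key
    have hzF : z ∉ Set.range (algebraMap F E) := by
      rintro ⟨a, rfl⟩
      refine hroot a ((algebraMap F E).injective ?_)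
      simpa using hz
    have hz0 : z ≠ 0 := by rintro rfl; exact hzF ⟨0, map_zero _⟩
    obtain ⟨h1, h2⟩ := trace_det_eq_of_sq_eq b (z := Units.mk0 z hz0) hzF (t := t) (n := n)
      (by rw [Units.val_mk0]; linear_combination hz)
    exact ⟨Units.mk0 z hz0, hzF, isConj_of_trace_eq_of_det_eq hg (by rwa [isScalar_torusHom])
      h1.symm h2.symm⟩

end Finite

end Torus
end Conj

/-! ### Class functions and orbit counting -/

section Counting

open scoped Classical

variable {G : Type*} [Group G]

/-- The number of elements conjugating `r` to `g`. -/
def conjCount (r g : G) : ℕ := Nat.card {x : G // x * r = g * x}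

/-- If nonempty, the set of elements conjugating `r` to `g` is a coset of the centralizer of `r`. -/
theorem conjCount_eq (r g : G) :
    conjCount r g = if IsConj r g then conjCount r r else 0 := by
  split_ifs with h
  · obtain ⟨c, rfl⟩ := isConj_iff.1 h
    refine Nat.card_congr ((Equiv.mulLeft c⁻¹).subtypeEquiv fun x => ?_)
    rw [Equiv.coe_mulLeft]
    constructor
    · intro h
      rw [mul_assoc, h]; group
    · intro h
      have := congrArg (c * ·) h
      simpa [mul_assoc] using this
  · refine Nat.card_eq_zero.2 (Or.inl ⟨fun x => h (isConj_iff.2 ⟨x.1, ?_⟩)⟩)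
    rw [mul_inv_eq_iff_eq_mul, x.2]

/-- A function that is constant on conjugacy classes. -/
def IsClassFun (f : G → ℂ) : Prop := ∀ g h, IsConj g h → f g = f h

theorem IsCharacter.isClassFun {f : G → ℂ} (hf : IsCharacter f) : IsClassFun f := by
  intro g h hgh
  obtain ⟨c, rfl⟩ := isConj_iff.1 hgh
  exact (hf.apply_conj g c).symm

theorem IsClassFun.sub {f h : G → ℂ} (hf : IsClassFun f) (hh : IsClassFun h) :
    IsClassFun (f - h) := fun x y hxy => by
  rw [Pi.sub_apply, Pi.sub_apply, hf x y hxy, hh x y hxy]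

theorem IsClassFun.mul {f h : G → ℂ} (hf : IsClassFun f) (hh : IsClassFun h) :
    IsClassFun (f * h) := fun x y hxy => by
  rw [Pi.mul_apply, Pi.mul_apply, hf x y hxy, hh x y hxy]

theorem IsClassFun.comp_inv {f : G → ℂ} (hf : IsClassFun f) :
    IsClassFun (fun g => f g⁻¹) := fun x y hxy => by
  refine hf _ _ ?_
  obtain ⟨c, rfl⟩ := isConj_iff.1 hxy
  exact isConj_iff.2 ⟨c, by group⟩

/-- Orbit–stabilizer in summed form: `x ↦ x r x⁻¹` hits each element of the class of `r` as often as
the centralizer has elements. -/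
theorem conjCount_mul_sum_isConj [Fintype G] {f : G → ℂ} (hf : IsClassFun f) (r : G) :
    (conjCount r r : ℂ) * ∑ g, (if IsConj r g then f g else 0) = Nat.card G * f r := by
  have h1 : ∑ x : G, f (x * r * x⁻¹) = Nat.card G * f r := by
    rw [Finset.sum_congr rfl fun x _ => (hf r _ (isConj_iff.2 ⟨x, rfl⟩)).symm]
    simp
  rw [← h1, ← Finset.sum_fiberwise Finset.univ (fun x : G => x * r * x⁻¹) (fun x => f (x * r * x⁻¹)),
    Finset.mul_sum]
  refine Finset.sum_congr rfl fun g _ => ?_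
  rw [Finset.sum_congr rfl (g := fun _ => f g)
    fun x hx => by rw [(Finset.mem_filter.1 hx).2], Finset.sum_const, nsmul_eq_mul]
  have h2 : (Finset.univ.filter fun x : G => x * r * x⁻¹ = g).card = conjCount r g := by
    rw [conjCount, Nat.card_eq_fintype_card, Fintype.card_subtype]
    simp only [mul_inv_eq_iff_eq_mul]
  rw [h2, conjCount_eq r g]
  split_ifs <;> simp

theorem sum_coe_monoidHom [Fintype G] (χ : G →* ℂˣ) :
    ∑ a, (χ a : ℂ) = if χ = 1 then (Nat.card G : ℂ) else 0 := by
  have h := sum_hom_units ((Units.coeHom ℂ).comp χ)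
  have hiff : (Units.coeHom ℂ).comp χ = 1 ↔ χ = 1 := by
    constructor
    · intro h
      ext a
      simpa using DFunLike.congr_fun h a
    · rintro rfl
      ext; simp
  simpa [hiff, Nat.card_eq_fintype_card] using h

end Counting

/-! ### The Weyl integration formula -/

section Weyl

open scoped Classical

variable {F E : Type*} [Field F] [Field E] [Algebra F E] (b : Module.Basis (Fin 2) F E)

/-- Equality of trace and determinant would make `z` a root of `(X - a)(X - d)`, hence an element of
`F`. -/
theorem not_isConj_upper_torusHom {a d : Fˣ} {x : F} {z : Eˣ}
    (hz : (z : E) ∉ Set.range (algebraMap F E)) : ¬ IsConj (upper a d x) (torusHom b z) := by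
  intro h
  have hsq := sq_eq_trace_mul_sub_det b z
  rw [← trace_eq_of_isConj h, ← det_eq_of_isConj h, trace_upper, det_upper, map_add, map_mul] at hsq
  have : ((z : E) - algebraMap F E a) * (z - algebraMap F E d) = 0 := by
    linear_combination hsq
  rcases mul_eq_zero.1 this with h | h
  · exact hz ⟨_, (sub_eq_zero.1 h).symm⟩
  · exact hz ⟨_, (sub_eq_zero.1 h).symm⟩

theorem isConj_torusHom_central {z : Eˣ} {a : Fˣ} :
    IsConj (torusHom b z) (upper a a 0) ↔ z = unitsEmb F E a := by
  rw [← torusHom_unitsEmb b]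
  constructor
  · intro h
    refine (torusHom_injective b (IsScalar.eq_of_isConj ?_ h.symm)).symm
    rw [torusHom_unitsEmb, isScalar_upper]
    simp
  · rintro rfl
    exact IsConj.refl _

variable (F) in
theorem unitsEmb_injective : Function.Injective (unitsEmb F E) :=
  Units.map_injective (algebraMap F E).injective

theorem mem_range_algebraMap_iff {z : Eˣ} :
    (z : E) ∈ Set.range (algebraMap F E) ↔ z ∈ Set.range (unitsEmb F E) := by
  constructor
  · rintro ⟨a, ha⟩
    have ha0 : a ≠ 0 := by rintro rfl; exact z.ne_zero (by rw [← ha, map_zero])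
    exact ⟨Units.mk0 a ha0, Units.ext ha⟩
  · rintro ⟨a, rfl⟩
    exact ⟨a, rfl⟩

/-- This and `sum_ite_notMem` replace sums over regular elements by sums over whole groups with a
correction, so that orthogonality of characters becomes available. -/
theorem sum_ite_ne [Fintype F] (u : Fˣ → Fˣ → ℂ) :
    ∑ a, ∑ d, (if a ≠ d then u a d else 0) = ∑ a, ∑ d, u a d - ∑ a, u a a := by
  rw [← Finset.sum_sub_distrib]
  refine Finset.sum_congr rfl fun a _ => ?_
  rw [eq_sub_iff_add_eq]
  have : u a a = ∑ d, if a = d then u a d else 0 := by simp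
  rw [this, ← Finset.sum_add_distrib]
  refine Finset.sum_congr rfl fun d _ => ?_
  split_ifs <;> simp_all

theorem sum_ite_notMem [Fintype F] [Fintype E] (u : Eˣ → ℂ) :
    ∑ z : Eˣ, (if (z : E) ∉ Set.range (algebraMap F E) then u z else 0) =
      ∑ z, u z - ∑ a : Fˣ, u (unitsEmb F E a) := by
  have h : ∑ a : Fˣ, u (unitsEmb F E a) =
      ∑ z : Eˣ, if (z : E) ∈ Set.range (algebraMap F E) then u z else 0 := by
    rw [← Finset.sum_filter, ← Finset.sum_image (f := u)
      (fun a _ a' _ h => unitsEmb_injective F (E := E) h)]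
    refine Finset.sum_congr ?_ fun _ _ => rfl
    ext z
    rw [Finset.mem_filter, mem_range_algebraMap_iff]
    simp
  rw [h, eq_sub_iff_add_eq, ← Finset.sum_add_distrib]
  refine Finset.sum_congr rfl fun d _ => ?_
  split_ifs <;> simp_all

section Finite

variable [Fintype F] [Fintype E]

/-- Every element of `GL(2, F)` is conjugate to exactly one of the normal forms, up to the
symmetries of the split and elliptic forms. -/
theorem sum_isConj_normalForm (g : GL (Fin 2) F) :
    ∑ a : Fˣ, (if IsConj (upper a a 0) g then (1 : ℂ) else 0) +
      ∑ a : Fˣ, (if IsConj (upper a a 1) g then (1 : ℂ) else 0) +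
      (∑ a : Fˣ, ∑ d : Fˣ,
        (if a ≠ d then (if IsConj (upper a d 0) g then (1 : ℂ) else 0) else 0)) / 2 +
      (∑ z : Eˣ, (if (z : E) ∉ Set.range (algebraMap F E) then
        (if IsConj (torusHom b z) g then (1 : ℂ) else 0) else 0)) / 2 = 1 := by
  have hconj : ∀ {r : GL (Fin 2) F} {g g'}, IsConj g g' → (IsConj r g ↔ IsConj r g') :=
    fun h => ⟨fun h' => h'.trans h, fun h' => h'.trans h.symm⟩
  rcases exists_isConj_normalForm b g with ⟨c, rfl⟩ | ⟨c, h⟩ | ⟨c, e, hce, h⟩ | ⟨w, hw, h⟩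
  · have e2 : ∀ a : Fˣ, ¬ IsConj (upper a a 1) (upper c c 0) := fun a h => by
      simpa [isScalar_upper] using isScalar_iff_of_isConj h
    have e3 : ∀ a d : Fˣ, a ≠ d → ¬ IsConj (upper a d 0) (upper c c 0) := fun a d had h => by
      simpa [isScalar_upper, had] using isScalar_iff_of_isConj h
    have e4 : ∀ z : Eˣ, (z : E) ∉ Set.range (algebraMap F E) →
        ¬ IsConj (torusHom b z) (upper c c 0) :=
      fun z hz h => not_isConj_upper_torusHom b hz h.symm
    simp +contextual only [isConj_upper_central, e2, e3, e4, if_false, ne_eq, not_false_iff,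
      ite_self, Finset.sum_const_zero]
    simp
  · simp only [hconj h]
    have e1 : ∀ a : Fˣ, ¬ IsConj (upper a a 0) (upper c c 1) := fun a h => by
      simpa [isScalar_upper] using isScalar_iff_of_isConj h
    have e3 : ∀ a d : Fˣ, a ≠ d → ¬ IsConj (upper a d 0) (upper c c 1) := fun a d had h => by
      rcases eq_or_eq_of_isConj_upper h with h | h <;> exact had (h.1.trans h.2.symm)
    have e4 : ∀ z : Eˣ, (z : E) ∉ Set.range (algebraMap F E) →
        ¬ IsConj (torusHom b z) (upper c c 1) :=
      fun z hz h => not_isConj_upper_torusHom b hz h.symm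
    simp +contextual only [isConj_upper_jordan, e1, e3, e4, if_false, ne_eq, not_false_iff,
      ite_self, Finset.sum_const_zero]
    simp
  · simp only [hconj h]
    have e1 : ∀ a x, ¬ IsConj (upper a a x) (upper c e 0) := fun a x h => by
      rcases eq_or_eq_of_isConj_upper h with h | h
      · exact hce (h.1.symm.trans h.2)
      · exact hce (h.2.symm.trans h.1)
    have e4 : ∀ z : Eˣ, (z : E) ∉ Set.range (algebraMap F E) →
        ¬ IsConj (torusHom b z) (upper c e 0) :=
      fun z hz h => not_isConj_upper_torusHom b hz h.symm
    -- As `c ≠ e`, exactly two ordered pairs contribute. The factor `1/2` compensates.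
    have e3 : ∀ a d : Fˣ, (if a ≠ d then (if IsConj (upper a d 0) (upper c e 0) then (1 : ℂ) else 0)
        else 0) = (if a = c then (if d = e then 1 else 0) else 0) +
          (if a = e then (if d = c then 1 else 0) else 0) := by
      intro a d
      simp only [isConj_upper_split hce, ← ite_and]
      by_cases h1 : a = c ∧ d = e
      · obtain ⟨rfl, rfl⟩ := h1
        simp [hce]
      · by_cases h2 : a = e ∧ d = c
        · obtain ⟨rfl, rfl⟩ := h2
          simp [hce, hce.symm]
        · rw [if_neg h1, if_neg h2, if_neg (fun h => not_or.2 ⟨h1, h2⟩ h.2), add_zero]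
    simp only [e3]
    simp +contextual only [e1, e4, if_false, not_false_iff,
      ite_self, Finset.sum_const_zero, Finset.sum_add_distrib]
    simp
  · simp only [hconj h]
    have e1 : ∀ a d x, ¬ IsConj (upper a d x) (torusHom b w) := fun a d x =>
      not_isConj_upper_torusHom b hw
    have hw1 : (w : E) ^ Nat.card F ∉ Set.range (algebraMap F E) := by
      rwa [pow_card_mem_range_iff b]
    have hw2 : w ≠ w ^ Nat.card F := by
      intro h
      have := congrArg Units.val h
      rw [Units.val_pow_eq_pow_val] at this
      exact hw (pow_card_eq_self_iff.1 this.symm)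
    -- Likewise exactly two torus elements, `w` and `w ^ q`, are conjugate to `m_w`, and they are
    -- distinct because `w` is not in `F`.
    have e4 : ∀ z : Eˣ, (if (z : E) ∉ Set.range (algebraMap F E) then
        (if IsConj (torusHom b z) (torusHom b w) then (1 : ℂ) else 0) else 0) =
        (if z = w then 1 else 0) + (if z = w ^ Nat.card F then 1 else 0) := by
      intro z
      simp only [isConj_torusHom b hw]
      by_cases h1 : z = w
      · subst h1
        rw [if_pos hw]
        simp [-Nat.card_eq_fintype_card, hw2]
      · by_cases h2 : z = w ^ Nat.card F
        · subst h2
          rw [Units.val_pow_eq_pow_val, if_pos hw1]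
          simp [-Nat.card_eq_fintype_card, hw2.symm]
        · simp [-Nat.card_eq_fintype_card, h1, h2]
    simp only [e4, e1, if_false, ite_self, Finset.sum_const_zero, Finset.sum_add_distrib]
    simp

variable (F) in
theorem natCard_units_eq : (Nat.card Fˣ : ℂ) = Nat.card F - 1 := by
  rw [Nat.card_units, Nat.cast_sub (Nat.one_le_iff_ne_zero.2 Nat.card_pos.ne'), Nat.cast_one]

omit [Fintype F] in
include b in
theorem natCard_ext_units_eq : (Nat.card Eˣ : ℂ) = (Nat.card F : ℂ) ^ 2 - 1 := by
  rw [natCard_units_eq, natCard_ext b, Nat.cast_pow]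

theorem natCard_GL_eq : (Nat.card (GL (Fin 2) F) : ℂ) =
    ((Nat.card F : ℂ) ^ 2 - 1) * ((Nat.card F : ℂ) ^ 2 - Nat.card F) := by
  have h : 0 < Nat.card F := Nat.card_pos
  rw [Matrix.card_GL_field, Fin.prod_univ_two, ← Nat.card_eq_fintype_card, Nat.cast_mul,
    Nat.cast_sub (Nat.pow_le_pow_right h (by simp)),
    Nat.cast_sub (Nat.pow_le_pow_right h (by simp))]
  simp

variable (F) in
theorem natCard_sub_one_ne_zero : (Nat.card F : ℂ) - 1 ≠ 0 := by
  rw [← natCard_units_eq]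
  simp

variable (F) in
omit [Field F] [Fintype F] in
theorem natCard_add_one_ne_zero : (Nat.card F : ℂ) + 1 ≠ 0 := by
  exact_mod_cast Nat.succ_ne_zero (Nat.card F)

/-- The Weyl integration formula for class functions on `GL(2, F)`. -/
theorem sum_classFun {f : GL (Fin 2) F → ℂ} (hf : IsClassFun f) :
    ∑ g, f g = ∑ a : Fˣ, f (upper a a 0) +
      ((Nat.card F : ℂ) ^ 2 - 1) * ∑ a : Fˣ, f (upper a a 1) +
      (Nat.card F : ℂ) * (Nat.card F + 1) / 2 *
        ∑ a : Fˣ, ∑ d : Fˣ, (if a ≠ d then f (upper a d 0) else 0) +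
      (Nat.card F : ℂ) * (Nat.card F - 1) / 2 *
        ∑ z : Eˣ, (if (z : E) ∉ Set.range (algebraMap F E) then f (torusHom b z) else 0) := by
  have hq0 : (Nat.card F : ℂ) ≠ 0 := by simp
  have hq1 := natCard_sub_one_ne_zero F
  have hq2 := natCard_add_one_ne_zero F
  -- Here `c` is the size of the class of `r`, determined by the order of the centralizer.
  have hclass : ∀ {r : GL (Fin 2) F} {c : ℂ}, (conjCount r r : ℂ) ≠ 0 →
      (conjCount r r : ℂ) * c = Nat.card (GL (Fin 2) F) →
      ∑ g, (if IsConj r g then f g else 0) = c * f r := by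
    intro r c h0 hc
    apply mul_left_cancel₀ h0
    rw [← mul_assoc, hc, ← conjCount_mul_sum_isConj hf]
    congr!
  have c1 : ∀ a : Fˣ, ∑ g, (if IsConj (upper a a 0) g then f g else 0) = f (upper a a 0) := by
    intro a
    rw [Finset.sum_eq_single (upper a a 0)]
    · rw [if_pos (IsConj.refl _)]
    · intro g _ hg
      rw [if_neg]
      intro h
      refine hg (IsScalar.eq_of_isConj ?_ h).symm
      simp [isScalar_upper]
    · exact fun h => absurd (Finset.mem_univ _) h
  have c2 : ∀ a : Fˣ, ∑ g, (if IsConj (upper a a 1) g then f g else 0) =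
      ((Nat.card F : ℂ) ^ 2 - 1) * f (upper a a 1) := by
    intro a
    have : (conjCount (upper a a 1) (upper a a 1) : ℂ) = Nat.card F * (Nat.card F - 1) := by
      rw [conjCount, card_centralizer_jordan, Nat.cast_mul, natCard_units_eq]
    refine hclass ?_ ?_ <;> rw [this]
    · exact mul_ne_zero hq0 hq1
    · rw [natCard_GL_eq]; ring
  have c3 : ∀ a d : Fˣ, a ≠ d → ∑ g, (if IsConj (upper a d 0) g then f g else 0) =
      (Nat.card F : ℂ) * (Nat.card F + 1) * f (upper a d 0) := by
    intro a d had
    have : (conjCount (upper a d 0) (upper a d 0) : ℂ) = (Nat.card F - 1) * (Nat.card F - 1) := by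
      rw [conjCount, card_centralizer_split had, Nat.cast_mul, natCard_units_eq]
    refine hclass ?_ ?_ <;> rw [this]
    · exact mul_ne_zero hq1 hq1
    · rw [natCard_GL_eq]; ring
  have c4 : ∀ z : Eˣ, (z : E) ∉ Set.range (algebraMap F E) →
      ∑ g, (if IsConj (torusHom b z) g then f g else 0) =
      (Nat.card F : ℂ) * (Nat.card F - 1) * f (torusHom b z) := by
    intro z hz
    have : (conjCount (torusHom b z) (torusHom b z) : ℂ) = (Nat.card F : ℂ) ^ 2 - 1 := by
      rw [conjCount, card_centralizer_elliptic b hz, natCard_ext_units_eq b]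
    refine hclass ?_ ?_ <;> rw [this]
    · rw [show (Nat.card F : ℂ) ^ 2 - 1 = (Nat.card F - 1) * (Nat.card F + 1) by ring]
      exact mul_ne_zero hq1 hq2
    · rw [natCard_GL_eq]; ring
  -- The normal form identity serves as a partition of unity. Interchanging the sums then gathers
  -- `f` class by class.
  have step : ∑ g, f g = ∑ g, f g *
      (∑ a : Fˣ, (if IsConj (upper a a 0) g then (1 : ℂ) else 0) +
      ∑ a : Fˣ, (if IsConj (upper a a 1) g then (1 : ℂ) else 0) +
      (∑ a : Fˣ, ∑ d : Fˣ,
        (if a ≠ d then (if IsConj (upper a d 0) g then (1 : ℂ) else 0) else 0)) / 2 +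
      (∑ z : Eˣ, (if (z : E) ∉ Set.range (algebraMap F E) then
        (if IsConj (torusHom b z) g then (1 : ℂ) else 0) else 0)) / 2) := by
    refine Finset.sum_congr rfl fun g _ => ?_
    rw [sum_isConj_normalForm b g, mul_one]
  rw [step]
  simp only [mul_add, Finset.sum_add_distrib, mul_div_assoc', Finset.mul_sum, ← Finset.sum_div,
    mul_ite, mul_one, mul_zero]
  congr 1
  · congr 1
    · congr 1
      · rw [Finset.sum_comm]
        exact Finset.sum_congr rfl fun a _ => c1 a
      · rw [Finset.sum_comm]
        exact Finset.sum_congr rfl fun a _ => c2 a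
    · rw [Finset.sum_comm, Finset.sum_div]
      refine Finset.sum_congr rfl fun a _ => ?_
      rw [Finset.sum_comm, Finset.sum_div]
      refine Finset.sum_congr rfl fun d _ => ?_
      split_ifs with h
      · rw [c3 a d h]; ring
      · simp
  · rw [Finset.sum_comm, Finset.sum_div]
    refine Finset.sum_congr rfl fun z _ => ?_
    split_ifs with h
    · simp
    · rw [c4 z h]; ring

end Finite
end Weyl

/-! ### Character values of the building blocks -/

section Characters

variable {F E : Type*} [Field F] [Field E] [Algebra F E] (b : Module.Basis (Fin 2) F E)

section DetCharacter

/-- The character `α ∘ det`. -/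
def detFun (α : Fˣ →* ℂˣ) (g : GL (Fin 2) F) : ℂ := α (GeneralLinearGroup.det g)

theorem isCharacter_detFun (α : Fˣ →* ℂˣ) : IsCharacter (detFun α) := by
  have : detFun α = (charRep (α.comp GeneralLinearGroup.det)).character := by
    ext g
    rw [charRep_character]; rfl
  rw [this]
  exact isCharacter_character _

theorem generalLinearGroup_det_upper (a d : Fˣ) (x : F) :
    GeneralLinearGroup.det (upper a d x) = a * d :=
  Units.ext (det_upper a d x)

theorem generalLinearGroup_det_torusHom (z : Eˣ) :
    GeneralLinearGroup.det (torusHom b z) = Units.map (Algebra.norm F : E →* F) z :=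
  Units.ext (Algebra.norm_eq_matrix_det b (z : E)).symm

theorem hasValues_detFun (α : Fˣ →* ℂˣ) : HasValues b (detFun α)
    (fun a => (α a : ℂ) ^ 2) (fun a => (α a : ℂ) ^ 2)
    (fun a d => (α a : ℂ) * (α d : ℂ)) (fun z => (compNorm E α z : ℂ)) where
  central_eq a := by simp [detFun, generalLinearGroup_det_upper, sq]
  jordan_eq a := by simp [detFun, generalLinearGroup_det_upper, sq]
  split_eq a d _ := by simp [detFun, generalLinearGroup_det_upper]
  elliptic_eq z _ := by simp [detFun, generalLinearGroup_det_torusHom, compNorm]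

end DetCharacter

section Principal

/-- The scalar matrices in `GL(2, F)`. -/
def scalarHom (F : Type*) [Field F] : Fˣ →* GL (Fin 2) F where
  toFun a := upper a a 0
  map_one' := by ext i j; fin_cases i <;> fin_cases j <;> simp
  map_mul' a d := by rw [upper_mul]; simp

theorem scalarHom_mulVec (a : Fˣ) (v : Fin 2 → F) :
    (scalarHom F a : Matrix (Fin 2) (Fin 2) F) *ᵥ v = (a : F) • v := by
  ext i
  fin_cases i <;> simp [scalarHom, upper_coe, Matrix.mulVec, dotProduct, Fin.sum_univ_two]

theorem inv_mulVec_mulVec (g : GL (Fin 2) F) (v : Fin 2 → F) :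
    ((g⁻¹ : GL (Fin 2) F) : Matrix (Fin 2) (Fin 2) F) *ᵥ
      ((g : Matrix (Fin 2) (Fin 2) F) *ᵥ v) = v := by
  rw [Matrix.mulVec_mulVec, ← Units.val_mul, inv_mul_cancel, Units.val_one, Matrix.one_mulVec]

theorem mulVec_inv_mulVec (g : GL (Fin 2) F) (v : Fin 2 → F) :
    (g : Matrix (Fin 2) (Fin 2) F) *ᵥ
      (((g⁻¹ : GL (Fin 2) F) : Matrix (Fin 2) (Fin 2) F) *ᵥ v) = v := by
  rw [Matrix.mulVec_mulVec, ← Units.val_mul, mul_inv_cancel, Units.val_one, Matrix.one_mulVec]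

/-- The action of `GL(2, F)` on the nonzero vectors. -/
def vecPerm (F : Type*) [Field F] : GL (Fin 2) F →* Equiv.Perm {v : Fin 2 → F // v ≠ 0} where
  toFun g :=
    { toFun := fun v => ⟨(g : Matrix (Fin 2) (Fin 2) F) *ᵥ v.1, fun h => v.2 (by
        rw [← inv_mulVec_mulVec g v.1, h, Matrix.mulVec_zero])⟩
      invFun := fun v => ⟨((g⁻¹ : GL (Fin 2) F) : Matrix (Fin 2) (Fin 2) F) *ᵥ v.1, fun h => v.2 (by
        rw [← mulVec_inv_mulVec g v.1, h, Matrix.mulVec_zero])⟩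
      left_inv := fun v => Subtype.ext (inv_mulVec_mulVec g v.1)
      right_inv := fun v => Subtype.ext (mulVec_inv_mulVec g v.1) }
  map_one' := Equiv.ext fun v => Subtype.ext (Matrix.one_mulVec v.1)
  map_mul' g h := Equiv.ext fun v => Subtype.ext
    (Matrix.mulVec_mulVec v.1 (g : Matrix (Fin 2) (Fin 2) F) (h : Matrix (Fin 2) (Fin 2) F)).symm

theorem vecPerm_coe (g : GL (Fin 2) F) (v : {v : Fin 2 → F // v ≠ 0}) :
    (vecPerm F g v : Fin 2 → F) = (g : Matrix (Fin 2) (Fin 2) F) *ᵥ v.1 := rfl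

/-- The number of nonzero eigenvectors of `g` with eigenvalue `a`. -/
def eigenCount (g : GL (Fin 2) F) (a : Fˣ) : ℕ :=
  Nat.card {v : {v : Fin 2 → F // v ≠ 0} // vecPerm F g v = vecPerm F (scalarHom F a) v}

/-- The character of the representation induced from the character `(α, β)` of the upper
triangular matrices. -/
def psFun (α β : Fˣ →* ℂˣ) [Fintype Fˣ] (g : GL (Fin 2) F) : ℂ :=
  detFun α g * ((Nat.card Fˣ : ℂ)⁻¹ * ∑ t : Fˣ, ((β * α⁻¹) t : ℂ) * (eigenCount g t : ℂ))

open scoped Classical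

variable [Fintype F]

/-- The model is the space of functions on nonzero vectors of `F²` that are homogeneous under
scalars with respect to `β * α⁻¹`, tensored with `α ∘ det`. The trace formula then counts
eigenvectors. -/
theorem isCharacter_psFun (α β : Fˣ →* ℂˣ) : IsCharacter (psFun α β) := by
  refine (isCharacter_detFun α).mul ?_
  have hlr : ∀ (g : GL (Fin 2) F) (a : Fˣ) (v : {v : Fin 2 → F // v ≠ 0}),
      vecPerm F g ((vecPerm F).comp (scalarHom F) a v) =
        (vecPerm F).comp (scalarHom F) a (vecPerm F g v) := by
    intro g a v
    refine Subtype.ext ?_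
    rw [MonoidHom.comp_apply, vecPerm_coe, vecPerm_coe, vecPerm_coe, vecPerm_coe, scalarHom_mulVec,
      scalarHom_mulVec, Matrix.mulVec_smul]
  have := eigenRep_character (vecPerm F) ((vecPerm F).comp (scalarHom F)) hlr (β * α⁻¹)
  convert isCharacter_character (eigenRep (vecPerm F) ((vecPerm F).comp (scalarHom F)) hlr
    (β * α⁻¹)) using 1
  ext g
  rw [this]
  rfl

omit [Fintype F] in
theorem eigenCount_eq (g : GL (Fin 2) F) (a : Fˣ) : eigenCount g a =
    Nat.card {p : F × F // p ≠ 0 ∧ g 0 0 * p.1 + g 0 1 * p.2 = a * p.1 ∧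
      g 1 0 * p.1 + g 1 1 * p.2 = a * p.2} := by
  refine Nat.card_congr ((Equiv.subtypeSubtypeEquivSubtypeExists _ _).trans
    ((finTwoArrowEquiv F).subtypeEquiv fun v => ?_))
  simp only [Subtype.ext_iff, vecPerm_coe, scalarHom_mulVec]
  constructor
  · rintro ⟨hv, h⟩
    refine ⟨fun h0 => hv ?_, ?_, ?_⟩
    · have h1 := congrArg Prod.fst h0
      have h2 := congrArg Prod.snd h0
      ext i
      fin_cases i
      · exact h1
      · exact h2
    · simpa [Matrix.mulVec, dotProduct, Fin.sum_univ_two] using congrFun h 0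
    · simpa [Matrix.mulVec, dotProduct, Fin.sum_univ_two] using congrFun h 1
  · rintro ⟨h0, h1, h2⟩
    refine ⟨?_, ?_⟩
    · rintro rfl
      exact h0 rfl
    · ext i
      fin_cases i
      · simpa [Matrix.mulVec, dotProduct, Fin.sum_univ_two] using h1
      · simpa [Matrix.mulVec, dotProduct, Fin.sum_univ_two] using h2

theorem eigenCount_central (a t : Fˣ) :
    (eigenCount (upper a a 0) t : ℂ) = if t = a then (Nat.card F : ℂ) ^ 2 - 1 else 0 := by
  rw [eigenCount_eq]
  simp only [upper_zero_zero, upper_zero_one, upper_one_zero, upper_one_one, zero_mul, add_zero,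
    zero_add]
  split_ifs with h
  · subst h
    simp only [and_true]
    rw [Nat.card_eq_fintype_card, Fintype.card_subtype_compl, Fintype.card_subtype_eq,
      Fintype.card_prod, Nat.cast_sub (Nat.mul_pos Fintype.card_pos Fintype.card_pos)]
    simp [sq]
  · rw [Nat.cast_eq_zero, Nat.card_eq_zero]
    left
    rw [isEmpty_subtype]
    rintro ⟨x, y⟩ ⟨h0, h1, h2⟩
    have hta : (a : F) ≠ t := fun h' => h (Units.ext h'.symm)
    refine h0 (Prod.ext ?_ ?_)
    · by_contra hx
      exact hta (mul_right_cancel₀ hx h1)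
    · by_contra hx
      exact hta (mul_right_cancel₀ hx h2)

omit [Fintype F] in
theorem eigenCount_jordan (a t : Fˣ) :
    (eigenCount (upper a a 1) t : ℂ) = if t = a then (Nat.card Fˣ : ℂ) else 0 := by
  rw [eigenCount_eq]
  simp only [upper_zero_zero, upper_zero_one, upper_one_zero, upper_one_one, zero_mul, one_mul,
    zero_add]
  split_ifs with h
  · subst h
    congr 1
    refine (Nat.card_congr (Equiv.ofBijective (fun x : Fˣ => ⟨((x : F), 0), by simp, by simp, by simp⟩)
      ⟨?_, ?_⟩)).symm
    · intro x y hxy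
      exact Units.ext (congrArg (fun p => p.1.1) hxy)
    · rintro ⟨⟨x, y⟩, h0, h1, h2⟩
      obtain rfl : y = 0 := by simpa using h1
      have hx : x ≠ 0 := by rintro rfl; exact h0 rfl
      exact ⟨Units.mk0 x hx, rfl⟩
  · rw [Nat.cast_eq_zero, Nat.card_eq_zero]
    left
    rw [isEmpty_subtype]
    rintro ⟨x, y⟩ ⟨h0, h1, h2⟩
    have hta : (a : F) ≠ t := fun h' => h (Units.ext h'.symm)
    have hy : y = 0 := by
      by_contra hx
      exact hta (mul_right_cancel₀ hx h2)
    subst hy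
    refine h0 (Prod.ext ?_ rfl)
    by_contra hx
    exact hta (mul_right_cancel₀ hx (by simpa using h1))

omit [Fintype F] in
theorem eigenCount_split {a d : Fˣ} (had : a ≠ d) (t : Fˣ) :
    (eigenCount (upper a d 0) t : ℂ) =
      (if t = a then (Nat.card Fˣ : ℂ) else 0) + if t = d then (Nat.card Fˣ : ℂ) else 0 := by
  rw [eigenCount_eq]
  simp only [upper_zero_zero, upper_zero_one, upper_one_zero, upper_one_one, zero_mul, add_zero,
    zero_add]
  have had' : (a : F) ≠ d := fun h' => had (Units.ext h')
  by_cases hta : t = a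
  · subst hta
    rw [if_pos rfl, if_neg had, add_zero]
    congr 1
    refine (Nat.card_congr (Equiv.ofBijective (fun x : Fˣ => ⟨((x : F), 0), by simp, by simp, by simp⟩)
      ⟨?_, ?_⟩)).symm
    · intro x y hxy
      exact Units.ext (congrArg (fun p => p.1.1) hxy)
    · rintro ⟨⟨x, y⟩, h0, h1, h2⟩
      obtain rfl : y = 0 := by
        by_contra hx
        exact had' (mul_right_cancel₀ hx h2).symm
      have hx : x ≠ 0 := by rintro rfl; exact h0 rfl
      exact ⟨Units.mk0 x hx, rfl⟩
  · have hta' : (a : F) ≠ t := fun h' => hta (Units.ext h'.symm)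
    have hx0 : ∀ x : F, (a : F) * x = t * x → x = 0 := by
      intro x hx
      by_contra hx0
      exact hta' (mul_right_cancel₀ hx0 hx)
    rw [if_neg hta, zero_add]
    split_ifs with htd
    · subst htd
      congr 1
      refine (Nat.card_congr (Equiv.ofBijective (fun y : Fˣ => ⟨(0, (y : F)), by simp, by simp, by simp⟩)
        ⟨?_, ?_⟩)).symm
      · intro x y hxy
        exact Units.ext (congrArg (fun p => p.1.2) hxy)
      · rintro ⟨⟨x, y⟩, h0, h1, h2⟩
        obtain rfl : x = 0 := hx0 x h1
        have hx : y ≠ 0 := by rintro rfl; exact h0 rfl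
        exact ⟨Units.mk0 y hx, rfl⟩
    · rw [Nat.cast_eq_zero, Nat.card_eq_zero]
      left
      rw [isEmpty_subtype]
      rintro ⟨x, y⟩ ⟨h0, h1, h2⟩
      have htd' : (d : F) ≠ t := fun h' => htd (Units.ext h'.symm)
      refine h0 (Prod.ext (hx0 x h1) ?_)
      by_contra hx
      exact htd' (mul_right_cancel₀ hx h2)

omit [Fintype F] in
-- An eigenvector would be a nonzero `w` in `E` with `z w = t w`, forcing `z = t`.
theorem eigenCount_elliptic {z : Eˣ} (hz : (z : E) ∉ Set.range (algebraMap F E)) (t : Fˣ) :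
    eigenCount (torusHom b z) t = 0 := by
  refine Nat.card_eq_zero.2 (Or.inl ⟨fun ⟨v, hv⟩ => ?_⟩)
  have hv' := congrArg Subtype.val hv
  rw [vecPerm_coe, vecPerm_coe, scalarHom_mulVec, torusHom_coe] at hv'
  set w := b.equivFun.symm v.1
  have hw : v.1 = b.repr w := by
    rw [← Module.Basis.equivFun_apply, LinearEquiv.apply_symm_apply]
  have hw0 : w ≠ 0 := by
    intro h
    apply v.2
    rw [hw, h, map_zero]
    rfl
  rw [hw, Algebra.leftMulMatrix_mulVec_repr] at hv'
  have h2 : (z : E) * w = (t : F) • w := by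
    apply b.repr.injective
    ext i
    rw [map_smul]
    exact congrFun hv' i
  rw [Algebra.smul_def] at h2
  exact hz ⟨t, (mul_right_cancel₀ hw0 h2).symm⟩

theorem hasValues_psFun (α β : Fˣ →* ℂˣ) : HasValues b (psFun α β)
    (fun a => ((Nat.card F : ℂ) + 1) * ((α a : ℂ) * (β a : ℂ)))
    (fun a => (α a : ℂ) * (β a : ℂ))
    (fun a d => (α a : ℂ) * (β d : ℂ) + (α d : ℂ) * (β a : ℂ)) (fun _ => 0) := by
  have hq := natCard_sub_one_ne_zero F
  constructor
  · intro a
    simp only [psFun, eigenCount_central, mul_ite, mul_zero, Finset.sum_ite_eq', Finset.mem_univ,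
      if_true, detFun, generalLinearGroup_det_upper, natCard_units_eq, MonoidHom.mul_apply,
      MonoidHom.inv_apply, Units.val_mul, Units.val_inv_eq_inv_val, map_mul]
    field_simp
    ring
  · intro a
    simp only [psFun, eigenCount_jordan, mul_ite, mul_zero, Finset.sum_ite_eq', Finset.mem_univ,
      if_true, detFun, generalLinearGroup_det_upper, natCard_units_eq, MonoidHom.mul_apply,
      MonoidHom.inv_apply, Units.val_mul, Units.val_inv_eq_inv_val, map_mul]
    field_simp
  · intro a d had
    simp only [psFun, eigenCount_split had, mul_add, Finset.sum_add_distrib, mul_ite, mul_zero,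
      Finset.sum_ite_eq', Finset.mem_univ,
      if_true, detFun, generalLinearGroup_det_upper, natCard_units_eq, MonoidHom.mul_apply,
      MonoidHom.inv_apply, Units.val_mul, Units.val_inv_eq_inv_val, map_mul]
    field_simp
    ring
  · intro z hz
    simp [psFun, eigenCount_elliptic b hz]

end Principal

section Torus

open scoped Classical

variable [Fintype F] [Fintype E]

/-- The character of the representation induced from the character `Λ` of the Coxeter torus. -/
def indFun (Λ : Eˣ →* ℂˣ) (g : GL (Fin 2) F) : ℂ :=
  (Nat.card Eˣ : ℂ)⁻¹ * ∑ z, (Λ z : ℂ) * (conjCount (torusHom b z) g : ℂ)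

/-- Right multiplication by the elements of the Coxeter torus. -/
def torusPerm : Eˣ →* Equiv.Perm (GL (Fin 2) F) where
  toFun z := Equiv.mulRight (torusHom b z)
  map_one' := by ext; simp
  map_mul' z w := by
    ext1 x
    simp [mul_comm z w, mul_assoc]

/-- The model is the space of functions on the group that are eigenfunctions under right translation
by the torus. -/
theorem isCharacter_indFun (Λ : Eˣ →* ℂˣ) : IsCharacter (indFun b Λ) := by
  have hlr : ∀ (g : GL (Fin 2) F) (z : Eˣ) (x : GL (Fin 2) F),
      MulAction.toPermHom (GL (Fin 2) F) (GL (Fin 2) F) g (torusPerm b z x) =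
        torusPerm b z (MulAction.toPermHom (GL (Fin 2) F) (GL (Fin 2) F) g x) := by
    intro g z x
    exact (mul_assoc g x (torusHom b z)).symm
  convert isCharacter_character (eigenRep _ (torusPerm b) hlr Λ) using 1
  ext g
  rw [eigenRep_character, indFun]
  congr 1
  refine Finset.sum_congr rfl fun z _ => ?_
  congr 2
  exact Nat.card_congr (Equiv.subtypeEquivRight fun x => eq_comm)

theorem hasValues_indFun (Λ : Eˣ →* ℂˣ) : HasValues b (indFun b Λ)
    (fun a => (Nat.card F : ℂ) * (Nat.card F - 1) * (res F Λ a : ℂ)) (fun _ => 0)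
    (fun _ _ => 0) (fun z => (Λ z : ℂ) + ((Λ ^ Nat.card F) z : ℂ)) := by
  have hE : (Nat.card Eˣ : ℂ) ≠ 0 := by simp
  have hzero : ∀ (a d : Fˣ) (x : F), ¬ IsScalar (upper a d x) →
      indFun b Λ (upper a d x) = 0 := by
    intro a d x h
    rw [indFun, Finset.sum_eq_zero, mul_zero]
    intro z _
    rw [conjCount_eq, if_neg, Nat.cast_zero, mul_zero]
    intro hc
    by_cases hz : (z : E) ∈ Set.range (algebraMap F E)
    · exact h ((isScalar_iff_of_isConj hc).1 ((isScalar_torusHom b).2 hz))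
    · exact not_isConj_upper_torusHom b hz hc.symm
  constructor
  · intro a
    -- A scalar is centralized by the whole group, and dividing its order by that of `Eˣ` gives `q
    -- (q - 1)`.
    have hcount : (conjCount (upper a a 0) (upper a a 0) : ℂ) =
        ((Nat.card F : ℂ) ^ 2 - 1) * ((Nat.card F : ℂ) ^ 2 - Nat.card F) := by
      rw [← natCard_GL_eq, conjCount]
      congr 1
      refine Nat.card_congr (Equiv.subtypeUnivEquiv fun x => ?_)
      ext i j
      fin_cases i <;> fin_cases j <;>
        simp [upper_coe, Matrix.mul_apply, Fin.sum_univ_two, mul_comm]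
    rw [indFun, Finset.sum_eq_single (unitsEmb F E a), torusHom_unitsEmb, hcount,
      ← natCard_ext_units_eq b]
    · change _ * ((res F Λ a : ℂ) * _) = _
      field_simp
    · intro z _ hz
      rw [conjCount_eq, if_neg, Nat.cast_zero, mul_zero]
      rwa [isConj_torusHom_central]
    · exact fun h => absurd (Finset.mem_univ _) h
  · intro a
    exact hzero a a 1 (by simp [isScalar_upper])
  · intro a d had
    exact hzero a d 0 (by simpa [isScalar_upper] using had)
  · intro w hw
    have hw2 : w ≠ w ^ Nat.card F := by
      intro h
      have := congrArg Units.val h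
      rw [Units.val_pow_eq_pow_val] at this
      exact hw (pow_card_eq_self_iff.1 this.symm)
    have hterm : ∀ z : Eˣ, (Λ z : ℂ) * (conjCount (torusHom b z) (torusHom b w) : ℂ) =
        (if z = w then (Λ z : ℂ) * Nat.card Eˣ else 0) +
          (if z = w ^ Nat.card F then (Λ z : ℂ) * Nat.card Eˣ else 0) := by
      intro z
      have hcount : ∀ {u : Eˣ}, (u : E) ∉ Set.range (algebraMap F E) →
          conjCount (torusHom b u) (torusHom b u) = Nat.card Eˣ :=
        fun hu => card_centralizer_elliptic b hu
      rw [conjCount_eq]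
      simp only [isConj_torusHom b hw]
      by_cases h1 : z = w
      · subst h1
        rw [if_pos (Or.inl rfl), hcount hw, if_pos rfl, if_neg hw2, add_zero]
      · by_cases h2 : z = w ^ Nat.card F
        · subst h2
          rw [if_pos (Or.inr rfl), hcount, if_neg h1, if_pos rfl, zero_add]
          rwa [Units.val_pow_eq_pow_val, pow_card_mem_range_iff b]
        · rw [if_neg (not_or.2 ⟨h1, h2⟩), if_neg h1, if_neg h2, Nat.cast_zero, mul_zero, add_zero]
    rw [indFun, Finset.sum_congr rfl fun z _ => hterm z, Finset.sum_add_distrib,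
      Finset.sum_ite_eq', Finset.sum_ite_eq', if_pos (Finset.mem_univ _),
      if_pos (Finset.mem_univ _), MonoidHom.pow_apply, map_pow]
    field_simp

/-- The virtual character that is the character of the cuspidal representation attached
to `Λ` when `Λ ≠ Λ ^ q`. -/
def cuspFun (Λ : Eˣ →* ℂˣ) : GL (Fin 2) F → ℂ :=
  psFun 1 1 * psFun (res F Λ) 1 - (psFun (res F Λ) 1 + psFun (res F Λ) 1 + indFun b Λ)

/-- Since `psFun 1 1` is the Steinberg character plus the trivial one, `cuspFun` is Steinberg times
`psFun λ 1`, minus `psFun λ 1`, minus `indFun b Λ`. The definition writes this as a difference of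
two genuine characters. -/
theorem hasValues_cuspFun (Λ : Eˣ →* ℂˣ) : HasValues b (cuspFun b Λ)
    (fun a => ((Nat.card F : ℂ) - 1) * (res F Λ a : ℂ))
    (fun a => -(res F Λ a : ℂ)) (fun _ _ => 0)
    (fun z => -((Λ z : ℂ) + ((Λ ^ Nat.card F) z : ℂ))) := by
  have h1 := hasValues_psFun b 1 1
  have h2 := hasValues_psFun b (res F Λ) 1
  have h3 := hasValues_indFun b Λ
  constructor
  · intro a
    simp only [cuspFun, Pi.sub_apply, Pi.mul_apply, Pi.add_apply, h1.central_eq, h2.central_eq,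
      h3.central_eq, MonoidHom.one_apply, Units.val_one]
    ring
  · intro a
    simp only [cuspFun, Pi.sub_apply, Pi.mul_apply, Pi.add_apply, h1.jordan_eq, h2.jordan_eq,
      h3.jordan_eq, MonoidHom.one_apply, Units.val_one]
    ring
  · intro a d had
    simp only [cuspFun, Pi.sub_apply, Pi.mul_apply, Pi.add_apply, h1.split_eq a d had,
      h2.split_eq a d had, h3.split_eq a d had, MonoidHom.one_apply, Units.val_one]
    ring
  · intro z hz
    simp only [cuspFun, Pi.sub_apply, Pi.mul_apply, Pi.add_apply, h1.elliptic_eq z hz,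
      h2.elliptic_eq z hz, h3.elliptic_eq z hz]
    ring

omit [Fintype E] in
theorem hasValues_steinberg (α : Fˣ →* ℂˣ) : HasValues b (psFun α α - detFun α)
    (fun a => (Nat.card F : ℂ) * (α a : ℂ) ^ 2) (fun _ => 0)
    (fun a d => (α a : ℂ) * (α d : ℂ)) (fun z => -(compNorm E α z : ℂ)) := by
  have h1 := hasValues_psFun b α α
  have h2 := hasValues_detFun b α
  constructor
  · intro a
    simp only [Pi.sub_apply, h1.central_eq, h2.central_eq]
    ring
  · intro a
    simp only [Pi.sub_apply, h1.jordan_eq, h2.jordan_eq]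
    ring
  · intro a d had
    simp only [Pi.sub_apply, h1.split_eq a d had, h2.split_eq a d had]
    ring
  · intro z hz
    simp only [Pi.sub_apply, h1.elliptic_eq z hz, h2.elliptic_eq z hz]
    ring

end Torus
end Characters

/-! ### Orthogonality for finite abelian groups -/

section Duality

open scoped Classical

variable {A : Type*} [CommGroup A] [Finite A]

instance : Finite (A →* ℂˣ) :=
  Nat.finite_of_card_ne_zero (by
    rw [CommGroup.card_monoidHom_of_hasEnoughRootsOfUnity A ℂ]
    exact Nat.card_pos.ne')

/-- Evaluation at `a` is a character of the dual group. It is trivial only for `a = 1`, since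
characters separate points. -/
theorem sum_monoidHom_apply [Fintype (A →* ℂˣ)] (a : A) :
    ∑ χ : A →* ℂˣ, (χ a : ℂ) = if a = 1 then (Nat.card A : ℂ) else 0 := by
  have h := sum_coe_monoidHom (MonoidHom.eval (N := ℂˣ) a)
  rw [CommGroup.card_monoidHom_of_hasEnoughRootsOfUnity A ℂ] at h
  have hiff : MonoidHom.eval (N := ℂˣ) a = 1 ↔ a = 1 := by
    rw [← CommGroup.forall_apply_eq_apply_iff A (M := ℂ), MonoidHom.ext_iff]
    simp
  simpa only [hiff, MonoidHom.eval_apply_apply] using h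

omit [Finite A] in
theorem sum_mul_inv_eq_delta [Fintype A] (χ ψ : A →* ℂˣ) :
    ∑ a, (χ a : ℂ) * (ψ⁻¹ a : ℂˣ) = Nat.card A * (delta χ ψ : ℂ) := by
  have h := sum_coe_monoidHom (χ * ψ⁻¹)
  simp only [MonoidHom.mul_apply, Units.val_mul] at h
  rw [h, delta]
  by_cases hχ : χ = ψ
  · rw [if_pos (mul_inv_eq_one.2 hχ), if_pos hχ, Int.cast_one, mul_one]
  · rw [if_neg (mt mul_inv_eq_one.1 hχ), if_neg hχ, Int.cast_zero, mul_zero]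

end Duality

/-! ### Norm computations and existence of the four families -/

section Table

open scoped Classical

variable {F E : Type*} [Field F] [Field E] [Algebra F E] (b : Module.Basis (Fin 2) F E)

theorem unitsEmb_pow_card [Finite F] (a : Fˣ) :
    unitsEmb F E a ^ Nat.card F = unitsEmb F E a := by
  refine Units.ext ?_
  rw [Units.val_pow_eq_pow_val]
  exact pow_card_eq_self_iff.2 ⟨a, rfl⟩

theorem apply_unitsEmb (Λ : Eˣ →* ℂˣ) (a : Fˣ) : Λ (unitsEmb F E a) = res F Λ a := rfl

theorem pow_card_apply_unitsEmb [Finite F] (Λ : Eˣ →* ℂˣ) (a : Fˣ) :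
    (Λ ^ Nat.card F) (unitsEmb F E a) = res F Λ a := by
  rw [MonoidHom.pow_apply, ← map_pow, unitsEmb_pow_card, apply_unitsEmb]

include b in
theorem compNorm_unitsEmb (α : Fˣ →* ℂˣ) (a : Fˣ) :
    compNorm E α (unitsEmb F E a) = α a ^ 2 := by
  have : Units.map (Algebra.norm F : E →* F) (unitsEmb F E a) = a ^ 2 := by
    refine Units.ext ?_
    simp [Algebra.norm_algebraMap, Module.finrank_eq_card_basis b]
  rw [compNorm, MonoidHom.comp_apply, this, map_pow]

variable [Fintype F] [Fintype E]

omit [Fintype E] in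
include b in
theorem ext_of_hasValues {f h : GL (Fin 2) F → ℂ} (hf : IsClassFun f) (hh : IsClassFun h)
    {c j : Fˣ → ℂ} {s : Fˣ → Fˣ → ℂ} {e : Eˣ → ℂ} (vf : HasValues b f c j s e)
    (vh : HasValues b h c j s e) : f = h := by
  ext g
  rcases exists_isConj_normalForm b g with ⟨a, rfl⟩ | ⟨a, hg⟩ | ⟨a, d, had, hg⟩ | ⟨w, hw, hg⟩
  · rw [vf.central_eq, vh.central_eq]
  · rw [hf _ _ hg, hh _ _ hg, vf.jordan_eq, vh.jordan_eq]
  · rw [hf _ _ hg, hh _ _ hg, vf.split_eq a d had, vh.split_eq a d had]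
  · rw [hf _ _ hg, hh _ _ hg, vf.elliptic_eq w hw, vh.elliptic_eq w hw]

/-- `HasValues` does not constrain `s` on the diagonal or `e` on `Fˣ`. Those values enter the full
sums and are subtracted again, so any convenient extension may be used. -/
theorem natCard_mul_pairing {f h : GL (Fin 2) F → ℂ} (hf : IsClassFun f) (hh : IsClassFun h)
    {c j c' j' : Fˣ → ℂ} {s s' : Fˣ → Fˣ → ℂ} {e e' : Eˣ → ℂ} (vf : HasValues b f c j s e)
    (vh : HasValues b h c' j' s' e') :
    (((Nat.card F : ℂ) ^ 2 - 1) * ((Nat.card F : ℂ) ^ 2 - Nat.card F)) * pairing f h =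
      ∑ a, c a * c' a⁻¹ + ((Nat.card F : ℂ) ^ 2 - 1) * ∑ a, j a * j' a⁻¹ +
      (Nat.card F : ℂ) * (Nat.card F + 1) / 2 *
        (∑ a, ∑ d, s a d * s' a⁻¹ d⁻¹ - ∑ a, s a a * s' a⁻¹ a⁻¹) +
      (Nat.card F : ℂ) * (Nat.card F - 1) / 2 *
        (∑ z, e z * e' z⁻¹ - ∑ a, e (unitsEmb F E a) * e' (unitsEmb F E a)⁻¹) := by
  have hG : (Nat.card (GL (Fin 2) F) : ℂ) ≠ 0 := by simp
  rw [← natCard_GL_eq, pairing, mul_inv_cancel_left₀ hG]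
  change ∑ g, (f * fun g => h g⁻¹) g = _
  rw [sum_classFun b (hf.mul hh.comp_inv), ← sum_ite_ne (fun a d => s a d * s' a⁻¹ d⁻¹),
    ← sum_ite_notMem (F := F) (fun z => e z * e' z⁻¹)]
  congr 1
  · congr 1
    · congr 1
      · refine Finset.sum_congr rfl fun a _ => ?_
        rw [Pi.mul_apply, upper_zero_inv, vf.central_eq, vh.central_eq]
      · congr 1
        refine Finset.sum_congr rfl fun a _ => ?_
        rw [Pi.mul_apply, vf.jordan_eq, ← vh.jordan_eq, upper_one_inv]
        congr 1
        -- The inverse of a Jordan block has upper right entry `-a⁻²`, which is nonzero and so can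
        -- be normalized to `1` by conjugation.
        exact hh _ _ (isConj_upper_of_ne_zero _ (neg_ne_zero.2 (Units.ne_zero _)))
    · congr 1
      refine Finset.sum_congr rfl fun a _ => Finset.sum_congr rfl fun d _ => ?_
      split_ifs with had
      · rw [Pi.mul_apply, upper_zero_inv, vf.split_eq a d had,
          vh.split_eq a⁻¹ d⁻¹ (inv_injective.ne had)]
      · rfl
  · congr 1
    refine Finset.sum_congr rfl fun z _ => ?_
    split_ifs with hz
    · rfl
    · rw [Pi.mul_apply, ← map_inv, vf.elliptic_eq z hz, vh.elliptic_eq z⁻¹ ?_]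
      rintro ⟨a, ha⟩
      refine hz ⟨a⁻¹, ?_⟩
      rw [map_inv₀, ha, Units.val_inv_eq_inv_val, inv_inv]

variable (F) in
omit [Field E] [Algebra F E] [Fintype E] in
theorem sum_units_one : ∑ _a : Fˣ, (1 : ℂ) = Nat.card F - 1 := by
  rw [← natCard_units_eq, Nat.card_eq_fintype_card]
  simp

omit [Fintype F] in
include b in
theorem sum_ext_units_one : ∑ _z : Eˣ, (1 : ℂ) = (Nat.card F : ℂ) ^ 2 - 1 := by
  rw [← natCard_ext_units_eq b, Nat.card_eq_fintype_card]
  simp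

variable (F) in
theorem natCard_GL_ne_zero :
    ((Nat.card F : ℂ) ^ 2 - 1) * ((Nat.card F : ℂ) ^ 2 - Nat.card F) ≠ 0 := by
  rw [← natCard_GL_eq]
  simp

omit [Field E] [Algebra F E] [Fintype E] in
theorem pairing_detFun (α : Fˣ →* ℂˣ) : pairing (detFun α) (detFun α) = 1 := by
  rw [pairing, Finset.sum_congr rfl (g := fun _ => (1 : ℂ)) fun g _ => by simp [detFun]]
  simp

include b in
theorem pairing_steinberg (α : Fˣ →* ℂˣ) :
    pairing (psFun α α - detFun α) (psFun α α - detFun α) = 1 := by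
  have hc := (isCharacter_psFun α α).isClassFun.sub (isCharacter_detFun α).isClassFun
  have hv := hasValues_steinberg b α
  apply mul_left_cancel₀ (natCard_GL_ne_zero F)
  rw [natCard_mul_pairing b hc hc hv hv]
  have e1 : ∀ a : Fˣ, (Nat.card F : ℂ) * (α a : ℂ) ^ 2 * ((Nat.card F : ℂ) * (α a⁻¹ : ℂ) ^ 2) =
      (Nat.card F : ℂ) ^ 2 * 1 := by
    intro a
    rw [map_inv, Units.val_inv_eq_inv_val]
    field_simp
  have e2 : ∀ a d : Fˣ, (α a : ℂ) * (α d : ℂ) * ((α a⁻¹ : ℂ) * (α d⁻¹ : ℂ)) = 1 := by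
    intro a d
    rw [map_inv, Units.val_inv_eq_inv_val, map_inv, Units.val_inv_eq_inv_val]
    field_simp
  have e3 : ∀ z : Eˣ, -(compNorm E α z : ℂ) * -(compNorm E α z⁻¹ : ℂ) = 1 := by
    intro z
    rw [map_inv, Units.val_inv_eq_inv_val]
    field_simp
  simp only [e1, e2, e3, ← Finset.mul_sum, sum_units_one, sum_ext_units_one b, mul_zero,
    Finset.sum_const_zero]
  rw [Finset.sum_congr rfl (g := fun _ => ((Nat.card F : ℂ) - 1) * 1) fun a _ => by ring,
    ← Finset.mul_sum, sum_units_one]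
  ring

include b in
theorem pairing_psFun {α β : Fˣ →* ℂˣ} (hαβ : α ≠ β) :
    pairing (psFun α β) (psFun α β) = 1 := by
  have hc := (isCharacter_psFun α β).isClassFun
  have hv := hasValues_psFun b α β
  apply mul_left_cancel₀ (natCard_GL_ne_zero F)
  rw [natCard_mul_pairing b hc hc hv hv]
  have e1 : ∀ a : Fˣ, ((Nat.card F : ℂ) + 1) * ((α a : ℂ) * (β a : ℂ)) *
      (((Nat.card F : ℂ) + 1) * ((α a⁻¹ : ℂ) * (β a⁻¹ : ℂ))) = ((Nat.card F : ℂ) + 1) ^ 2 * 1 := by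
    intro a
    simp only [map_inv, Units.val_inv_eq_inv_val]
    field_simp
  have e2 : ∀ a : Fˣ, (α a : ℂ) * (β a : ℂ) * ((α a⁻¹ : ℂ) * (β a⁻¹ : ℂ)) = 1 := by
    intro a
    simp only [map_inv, Units.val_inv_eq_inv_val]
    field_simp
  -- The mixed terms factor into a function of `a` times a function of `d`. Both factors are
  -- nontrivial characters because `α ≠ β`, so their sums vanish.
  have e3 : ∀ a d : Fˣ, ((α a : ℂ) * (β d : ℂ) + (α d : ℂ) * (β a : ℂ)) *
      ((α a⁻¹ : ℂ) * (β d⁻¹ : ℂ) + (α d⁻¹ : ℂ) * (β a⁻¹ : ℂ)) =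
      2 * 1 + (((α * β⁻¹) a : ℂˣ) : ℂ) * (((β * α⁻¹) d : ℂˣ) : ℂ) +
        (((β * α⁻¹) a : ℂˣ) : ℂ) * (((α * β⁻¹) d : ℂˣ) : ℂ) := by
    intro a d
    simp only [map_inv, Units.val_inv_eq_inv_val, MonoidHom.mul_apply, MonoidHom.inv_apply,
      Units.val_mul]
    field_simp
    ring
  have e4 : ∀ a : Fˣ, ((α a : ℂ) * (β a : ℂ) + (α a : ℂ) * (β a : ℂ)) *
      ((α a⁻¹ : ℂ) * (β a⁻¹ : ℂ) + (α a⁻¹ : ℂ) * (β a⁻¹ : ℂ)) = 4 * 1 := by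
    intro a
    simp only [map_inv, Units.val_inv_eq_inv_val]
    field_simp
    ring
  have h0 : ∑ a, (((α * β⁻¹) a : ℂˣ) : ℂ) = 0 := by
    rw [sum_coe_monoidHom, if_neg]
    exact fun h => hαβ (mul_inv_eq_one.1 h)
  have h1 : ∑ a, (((β * α⁻¹) a : ℂˣ) : ℂ) = 0 := by
    rw [sum_coe_monoidHom, if_neg]
    exact fun h => hαβ (mul_inv_eq_one.1 h).symm
  have h2 : ∑ a : Fˣ, ∑ d : Fˣ, (2 * (1 : ℂ) + (((α * β⁻¹) a : ℂˣ) : ℂ) * (((β * α⁻¹) d : ℂˣ) : ℂ) +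
        (((β * α⁻¹) a : ℂˣ) : ℂ) * (((α * β⁻¹) d : ℂˣ) : ℂ)) =
      2 * ((Nat.card F : ℂ) - 1) ^ 2 := by
    have : ∀ a : Fˣ, ∑ d : Fˣ, (2 * (1 : ℂ) +
        (((α * β⁻¹) a : ℂˣ) : ℂ) * (((β * α⁻¹) d : ℂˣ) : ℂ) +
        (((β * α⁻¹) a : ℂˣ) : ℂ) * (((α * β⁻¹) d : ℂˣ) : ℂ)) =
        2 * ((Nat.card F : ℂ) - 1) * 1 := by
      intro a
      rw [Finset.sum_add_distrib, Finset.sum_add_distrib, ← Finset.mul_sum, ← Finset.mul_sum,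
        ← Finset.mul_sum, h0, h1, sum_units_one]
      ring
    simp only [this]
    rw [← Finset.mul_sum, sum_units_one]
    ring
  rw [Finset.sum_congr rfl fun a _ => e4 a]
  simp only [e1, e2, e3, h2, mul_zero, Finset.sum_const_zero]
  rw [← Finset.mul_sum, ← Finset.mul_sum, sum_units_one]
  ring

theorem isClassFun_cuspFun (Λ : Eˣ →* ℂˣ) : IsClassFun (cuspFun b Λ) :=
  ((isCharacter_psFun _ _).mul (isCharacter_psFun _ _)).isClassFun.sub
    (((isCharacter_psFun _ _).add (isCharacter_psFun _ _)).add (isCharacter_indFun b Λ)).isClassFun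

theorem pairing_cuspFun {Λ : Eˣ →* ℂˣ} (hΛ : Λ ≠ Λ ^ Nat.card F) :
    pairing (cuspFun b Λ) (cuspFun b Λ) = 1 := by
  have hc := isClassFun_cuspFun b Λ
  have hv := hasValues_cuspFun b Λ
  apply mul_left_cancel₀ (natCard_GL_ne_zero F)
  rw [natCard_mul_pairing b hc hc hv hv]
  have e1 : ∀ a : Fˣ, ((Nat.card F : ℂ) - 1) * (res F Λ a : ℂ) *
      (((Nat.card F : ℂ) - 1) * (res F Λ a⁻¹ : ℂ)) = ((Nat.card F : ℂ) - 1) ^ 2 * 1 := by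
    intro a
    simp only [map_inv, Units.val_inv_eq_inv_val]
    field_simp
  have e2 : ∀ a : Fˣ, -(res F Λ a : ℂ) * -(res F Λ a⁻¹ : ℂ) = 1 := by
    intro a
    simp only [map_inv, Units.val_inv_eq_inv_val]
    field_simp
  -- The mixed terms are the characters `Λ / Λ ^ q` and its inverse, nontrivial by `hΛ`.
  have e3 : ∀ z : Eˣ, -((Λ z : ℂ) + ((Λ ^ Nat.card F) z : ℂ)) *
      -((Λ z⁻¹ : ℂ) + ((Λ ^ Nat.card F) z⁻¹ : ℂ)) =
      2 * 1 + (((Λ * (Λ ^ Nat.card F)⁻¹) z : ℂˣ) : ℂ) +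
        ((((Λ ^ Nat.card F) * Λ⁻¹) z : ℂˣ) : ℂ) := by
    intro z
    generalize Λ ^ Nat.card F = M
    simp only [map_inv, Units.val_inv_eq_inv_val, MonoidHom.mul_apply, MonoidHom.inv_apply,
      Units.val_mul]
    field_simp
    ring
  have e4 : ∀ a : Fˣ, -((Λ (unitsEmb F E a) : ℂ) + ((Λ ^ Nat.card F) (unitsEmb F E a) : ℂ)) *
      -((Λ (unitsEmb F E a)⁻¹ : ℂ) + ((Λ ^ Nat.card F) (unitsEmb F E a)⁻¹ : ℂ)) = 4 * 1 := by
    intro a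
    rw [← map_inv (unitsEmb F E), pow_card_apply_unitsEmb, pow_card_apply_unitsEmb,
      apply_unitsEmb, apply_unitsEmb]
    simp only [map_inv, Units.val_inv_eq_inv_val]
    field_simp
    ring
  have h0 : ∑ z, (((Λ * (Λ ^ Nat.card F)⁻¹) z : ℂˣ) : ℂ) = 0 := by
    rw [sum_coe_monoidHom, if_neg]
    exact fun h => hΛ (mul_inv_eq_one.1 h)
  have h1 : ∑ z, ((((Λ ^ Nat.card F) * Λ⁻¹) z : ℂˣ) : ℂ) = 0 := by
    rw [sum_coe_monoidHom, if_neg]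
    exact fun h => hΛ (mul_inv_eq_one.1 h).symm
  rw [Finset.sum_congr rfl fun a _ => e4 a]
  simp only [e1, e2, e3, mul_zero, Finset.sum_const_zero]
  rw [Finset.sum_add_distrib, Finset.sum_add_distrib, h0, h1]
  simp only [← Finset.mul_sum, sum_units_one, sum_ext_units_one b]
  ring

omit [Fintype F] [Fintype E] in
theorem upper_one_one_zero : upper (1 : Fˣ) 1 0 = 1 := (scalarHom F).map_one

omit [Fintype F] in
-- Allows a genuine character of norm one to be treated as a difference of characters.
theorem isCharacter_zero : IsCharacter (0 : GL (Fin 2) F → ℂ) :=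
  ⟨0, 1, by
    ext g
    rw [Representation.character, Subsingleton.elim ((1 : Representation ℂ _ (Fin 0 → ℂ)) g) 0,
      map_zero]
    rfl⟩

omit [Fintype E] in
theorem exists_isOneDim (α : Fˣ →* ℂˣ) :
    ∃ π : Representation ℂ (GL (Fin 2) F) (Fin 1 → ℂ), IsOneDim b α π ∧
      π.character = detFun α := by
  have hv := hasValues_detFun b α
  obtain ⟨π, hirr, hπ⟩ := exists_isIrreducible_of_pairing_eq_one (isCharacter_detFun α)
    isCharacter_zero (by rw [sub_zero, pairing_detFun]) 1 (by
      rw [← upper_one_one_zero, hv.central_eq]; simp)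
  rw [sub_zero] at hπ
  exact ⟨π, ⟨hirr, hπ ▸ hv⟩, hπ⟩

theorem exists_isSteinberg (α : Fˣ →* ℂˣ) :
    ∃ π : Representation ℂ (GL (Fin 2) F) (Fin (Nat.card F) → ℂ), IsSteinberg b α π ∧
      π.character = psFun α α - detFun α := by
  have hv := hasValues_steinberg b α
  obtain ⟨π, hirr, hπ⟩ := exists_isIrreducible_of_pairing_eq_one (isCharacter_psFun α α)
    (isCharacter_detFun α) (pairing_steinberg b α) (Nat.card F) (by
      rw [← Pi.sub_apply, ← upper_one_one_zero, hv.central_eq]; simp)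
  exact ⟨π, ⟨hirr, hπ ▸ hv⟩, hπ⟩

theorem exists_isPrincipal {α β : Fˣ →* ℂˣ} (hαβ : α ≠ β) :
    ∃ π : Representation ℂ (GL (Fin 2) F) (Fin (Nat.card F + 1) → ℂ), IsPrincipal b α β π ∧
      π.character = psFun α β := by
  have hv := hasValues_psFun b α β
  obtain ⟨π, hirr, hπ⟩ := exists_isIrreducible_of_pairing_eq_one (isCharacter_psFun α β)
    isCharacter_zero (by rw [sub_zero, pairing_psFun b hαβ]) (Nat.card F + 1) (by
      rw [← upper_one_one_zero, hv.central_eq]; simp)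
  rw [sub_zero] at hπ
  exact ⟨π, ⟨hirr, hπ ▸ hv⟩, hπ⟩

theorem exists_isCuspidal {Λ : Eˣ →* ℂˣ} (hΛ : Λ ≠ Λ ^ Nat.card F) :
    ∃ π : Representation ℂ (GL (Fin 2) F) (Fin (Nat.card F - 1) → ℂ), IsCuspidal b Λ π ∧
      π.character = cuspFun b Λ := by
  have hv := hasValues_cuspFun b Λ
  obtain ⟨π, hirr, hπ⟩ := exists_isIrreducible_of_pairing_eq_one
    ((isCharacter_psFun 1 1).mul (isCharacter_psFun (res F Λ) 1))
    (((isCharacter_psFun (res F Λ) 1).add (isCharacter_psFun (res F Λ) 1)).add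
      (isCharacter_indFun b Λ)) (pairing_cuspFun b hΛ) (Nat.card F - 1) (by
      rw [← Pi.sub_apply]
      change cuspFun b Λ 1 = _
      rw [← upper_one_one_zero, hv.central_eq, Nat.cast_sub Nat.card_pos]; simp)
  exact ⟨π, ⟨hirr, hπ ▸ hv⟩, hπ⟩

end Table

/-! ### The multiplicities -/

section Multiplicity

open scoped Classical

variable {F E : Type*} [Field F] [Field E] [Algebra F E] (b : Module.Basis (Fin 2) F E)
  [Fintype F] [Fintype E] {V : Type*} [AddCommGroup V] [Module ℂ V] [FiniteDimensional ℂ V]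
  {π : Representation ℂ (GL (Fin 2) F) V}

/-- Jordan and split values do not enter, since the torus contains no such elements. The elliptic
formula is summed over all of `Eˣ` and corrected on `Fˣ`. -/
theorem natCard_mul_mult {c j : Fˣ → ℂ} {s : Fˣ → Fˣ → ℂ} {e : Eˣ → ℂ}
    (h : HasValues b π.character c j s e) (Φ : Eˣ →* ℂˣ) :
    ((Nat.card F : ℂ) ^ 2 - 1) * (mult π (indTorus b Φ) : ℂ) =
      ∑ a, c a * ((res F Φ)⁻¹ a : ℂˣ) + (∑ z, e z * (Φ⁻¹ z : ℂˣ) -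
        ∑ a, e (unitsEmb F E a) * ((res F Φ)⁻¹ a : ℂˣ)) := by
  have hE : (Nat.card Eˣ : ℂ) ≠ 0 := by simp
  rw [mult_ind_eq, ← natCard_ext_units_eq b, mul_inv_cancel_left₀ hE,
    eq_comm, ← eq_sub_iff_add_eq']
  have key := sum_ite_notMem (F := F) fun z => π.character (torusHom b z) * (Φ⁻¹ z : ℂˣ)
  have key' := sum_ite_notMem (F := F) fun z => e z * (Φ⁻¹ z : ℂˣ)
  have h1 : ∀ a, ((res F Φ)⁻¹ a : ℂˣ) = Φ⁻¹ (unitsEmb F E a) := fun a => rfl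
  simp only [h1, ← h.central_eq, ← torusHom_unitsEmb b]
  rw [← key, ← key']
  refine Finset.sum_congr rfl fun z _ => ?_
  split_ifs with hz
  · rfl
  · rw [h.elliptic_eq z hz]

omit [Fintype F] in
include b in
theorem sq_natCard_sub_one_ne_zero : (Nat.card F : ℂ) ^ 2 - 1 ≠ 0 := by
  rw [← natCard_ext_units_eq b]
  simp

theorem mult_of_isOneDim {α : Fˣ →* ℂˣ} (h : IsOneDim b α π) (Φ : Eˣ →* ℂˣ) :
    (mult π (indTorus b Φ) : ℤ) = delta (compNorm E α) Φ := by
  have key := natCard_mul_mult b h.values Φ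
  have e1 : ∀ a : Fˣ, (compNorm E α (unitsEmb F E a) : ℂ) = (α a : ℂ) ^ 2 := fun a => by
    rw [compNorm_unitsEmb b, Units.val_pow_eq_pow_val]
  simp only [e1] at key
  rw [sum_mul_inv_eq_delta, natCard_ext_units_eq b, add_sub_cancel] at key
  exact_mod_cast mul_left_cancel₀ (sq_natCard_sub_one_ne_zero b) key

/-- In the families of dimension `q`, `q + 1` and `q - 1`, the central value minus the extended
elliptic value is `q + 1` times the central character. Summing over `Fˣ` gives `(q + 1)(q - 1)`,
which cancels the factor `q² - 1`. For dimension one this difference is zero. -/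
theorem mult_of_isSteinberg {α : Fˣ →* ℂˣ} (h : IsSteinberg b α π) (Φ : Eˣ →* ℂˣ) :
    (mult π (indTorus b Φ) : ℤ) = delta (α ^ 2) (res F Φ) - delta (compNorm E α) Φ := by
  have key := natCard_mul_mult b h.values Φ
  have e1 : ∀ a : Fˣ, (compNorm E α (unitsEmb F E a) : ℂ) = ((α ^ 2) a : ℂˣ) := fun a => by
    rw [compNorm_unitsEmb b, MonoidHom.pow_apply]
  have e2 : ∀ a : Fˣ, (α a : ℂ) ^ 2 = ((α ^ 2) a : ℂˣ) := fun a => by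
    rw [MonoidHom.pow_apply, Units.val_pow_eq_pow_val]
  simp only [e1, e2, neg_mul, Finset.sum_neg_distrib, mul_assoc, ← Finset.mul_sum] at key
  rw [sum_mul_inv_eq_delta, sum_mul_inv_eq_delta, natCard_ext_units_eq b, natCard_units_eq] at key
  have : (mult π (indTorus b Φ) : ℂ) =
      (delta (α ^ 2) (res F Φ) : ℂ) - (delta (compNorm E α) Φ : ℂ) := by
    apply mul_left_cancel₀ (sq_natCard_sub_one_ne_zero b)
    rw [key]
    ring
  exact_mod_cast this

theorem mult_of_isPrincipal {α β : Fˣ →* ℂˣ} (h : IsPrincipal b α β π) (Φ : Eˣ →* ℂˣ) :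
    (mult π (indTorus b Φ) : ℤ) = delta (α * β) (res F Φ) := by
  have key := natCard_mul_mult b h.values Φ
  have e2 : ∀ a : Fˣ, (α a : ℂ) * (β a : ℂ) = ((α * β) a : ℂˣ) := fun a => by
    rw [MonoidHom.mul_apply, Units.val_mul]
  simp only [e2, zero_mul, Finset.sum_const_zero, mul_assoc, ← Finset.mul_sum] at key
  rw [sum_mul_inv_eq_delta, natCard_units_eq] at key
  have : (mult π (indTorus b Φ) : ℂ) = (delta (α * β) (res F Φ) : ℂ) := by
    apply mul_left_cancel₀ (sq_natCard_sub_one_ne_zero b)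
    rw [key]
    ring
  exact_mod_cast this

theorem mult_of_isCuspidal {Λ : Eˣ →* ℂˣ} (h : IsCuspidal b Λ π) (Φ : Eˣ →* ℂˣ) :
    (mult π (indTorus b Φ) : ℤ) = delta (res F Λ) (res F Φ) - delta Λ Φ -
      delta (Λ ^ Nat.card F) Φ := by
  have key := natCard_mul_mult b h.values Φ
  simp only [pow_card_apply_unitsEmb] at key
  simp only [apply_unitsEmb, neg_mul, add_mul, Finset.sum_add_distrib,
    Finset.sum_neg_distrib, mul_assoc, ← Finset.mul_sum] at key
  rw [sum_mul_inv_eq_delta, sum_mul_inv_eq_delta, sum_mul_inv_eq_delta, natCard_ext_units_eq b,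
    natCard_units_eq] at key
  have : (mult π (indTorus b Φ) : ℂ) = (delta (res F Λ) (res F Φ) : ℂ) - (delta Λ Φ : ℂ) -
      (delta (Λ ^ Nat.card F) Φ : ℂ) := by
    apply mul_left_cancel₀ (sq_natCard_sub_one_ne_zero b)
    rw [key]
    ring
  exact_mod_cast this

end Multiplicity

/-! ### Completeness of the list -/

section Completeness

open scoped Classical

variable {F E : Type*} [Field F] [Field E] [Algebra F E] (b : Module.Basis (Fin 2) F E)
  [Fintype F] [Fintype E]

include b in
/-- A character of `Eˣ` that is invariant under the Frobenius factors through the norm. -/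
theorem exists_eq_compNorm_of_eq_pow_card {Λ : Eˣ →* ℂˣ} (hΛ : Λ = Λ ^ Nat.card F) :
    ∃ α : Fˣ →* ℂˣ, Λ = compNorm E α := by
  have hfin := Module.Finite.of_basis b
  have hq : 1 < Nat.card F := Finite.one_lt_card
  -- An element of norm one satisfies `z ^ (q + 1) = 1`.
  have hker : (Units.map (Algebra.norm F : E →* F)).ker ≤ Λ.ker := by
    intro z hz
    rw [MonoidHom.mem_ker] at hz ⊢
    have hz1 : z ^ (Nat.card F + 1) = 1 := by
      have h := FiniteField.algebraMap_norm_eq_pow_sum F E (z : E)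
      rw [Module.finrank_eq_card_basis b, Fintype.card_fin, Finset.sum_range_succ,
        Finset.sum_range_one, pow_zero, pow_one] at h
      have hn : Algebra.norm F (z : E) = 1 := congrArg Units.val hz
      rw [hn, map_one, add_comm] at h
      exact Units.ext (by rw [Units.val_pow_eq_pow_val, ← h, Units.val_one])
    obtain ⟨g, hg⟩ := IsCyclic.exists_generator (α := Eˣ)
    obtain ⟨k, rfl⟩ := (mem_powers_iff_mem_zpowers.2 (hg z) : z ∈ Submonoid.powers g)
    have hord : orderOf g = (Nat.card F - 1) * (Nat.card F + 1) := by
      rw [orderOf_eq_card_of_forall_mem_zpowers hg, Nat.card_units, natCard_ext b,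
        ← one_pow 2, Nat.sq_sub_sq, one_pow, mul_comm]
    simp only [← pow_mul] at hz1
    have hdvd := orderOf_dvd_of_pow_eq_one hz1
    rw [hord] at hdvd
    -- In the cyclic group `Eˣ` of order `(q - 1)(q + 1)` such an element is a power of `g ^ (q -
    -- 1)`, and `Λ` kills it because `Λ ^ (q - 1) = 1`.
    obtain ⟨m, rfl⟩ := Nat.dvd_of_mul_dvd_mul_right (Nat.succ_pos _) hdvd
    simp only
    rw [pow_mul, map_pow, map_pow]
    have : Λ g ^ (Nat.card F - 1) = 1 := by
      have h := DFunLike.congr_fun hΛ g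
      rw [MonoidHom.pow_apply, ← Nat.sub_add_cancel hq.le, pow_succ] at h
      exact (mul_eq_right.1 h.symm)
    rw [this, one_pow]
  refine ⟨MonoidHom.liftOfSurjective _ (FiniteField.unitsMap_norm_surjective F E) ⟨Λ, hker⟩, ?_⟩
  exact (MonoidHom.liftOfRightInverse_comp _ _ _ ⟨Λ, hker⟩).symm

/-- The regular character is a combination of the principal and cuspidal virtual characters. -/
theorem pairing_regular [Fintype (Fˣ →* ℂˣ)] [Fintype (Eˣ →* ℂˣ)] {χ : GL (Fin 2) F → ℂ} (hχ : IsClassFun χ) :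
    ((Nat.card F : ℂ) + 1) / 2 * ∑ α : Fˣ →* ℂˣ, ∑ β : Fˣ →* ℂˣ, pairing (psFun α β) χ +
      ((Nat.card F : ℂ) - 1) / 2 * ∑ Λ : Eˣ →* ℂˣ, pairing (cuspFun b Λ) χ = χ 1 := by
  have hvχ : HasValues b χ (fun a => χ (upper a a 0)) (fun a => χ (upper a a 1))
      (fun a d => χ (upper a d 0)) (fun z => χ (torusHom b z)) :=
    ⟨fun _ => rfl, fun _ => rfl, fun _ _ _ => rfl, fun _ _ => rfl⟩
  -- Each irreducible should occur as often as its degree. The halves account for the pairs `(α,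
  -- β)`, `(β, α)` and `Λ`, `Λ ^ q`. In the degenerate cases the sum and the difference of the
  -- Steinberg character and `α ∘ det`, with weights `(q + 1)/2` and `(q - 1)/2`, combine to `q`
  -- times the former plus the latter.
  set R : GL (Fin 2) F → ℂ :=
    (((Nat.card F : ℂ) + 1) / 2) • ∑ α : Fˣ →* ℂˣ, ∑ β : Fˣ →* ℂˣ, psFun α β +
      (((Nat.card F : ℂ) - 1) / 2) • ∑ Λ : Eˣ →* ℂˣ, cuspFun b Λ with hR
  have hRapp : ∀ g, R g = ((Nat.card F : ℂ) + 1) / 2 *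
      ∑ α : Fˣ →* ℂˣ, ∑ β : Fˣ →* ℂˣ, psFun α β g +
      ((Nat.card F : ℂ) - 1) / 2 * ∑ Λ : Eˣ →* ℂˣ, cuspFun b Λ g := by
    intro g
    simp only [hR, Pi.add_apply, Pi.smul_apply, Finset.sum_apply, smul_eq_mul]
  have hRc : IsClassFun R := by
    intro g h hgh
    rw [hRapp, hRapp]
    congr 2
    · exact Finset.sum_congr rfl fun α _ => Finset.sum_congr rfl fun β _ =>
        (isCharacter_psFun α β).isClassFun g h hgh
    · exact Finset.sum_congr rfl fun Λ _ => isClassFun_cuspFun b Λ g h hgh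
  have hprod : ∀ a d : Fˣ, ∑ α : Fˣ →* ℂˣ, ∑ β : Fˣ →* ℂˣ, (α a : ℂ) * (β d : ℂ) =
      (if a = 1 then (Nat.card Fˣ : ℂ) else 0) * (if d = 1 then (Nat.card Fˣ : ℂ) else 0) := by
    intro a d
    simp only [← Finset.sum_mul_sum, sum_monoidHom_apply]
    congr
  have hres : ∀ a : Fˣ, ∑ Λ : Eˣ →* ℂˣ, (res F Λ a : ℂ) =
      if a = 1 then (Nat.card Eˣ : ℂ) else 0 := by
    intro a
    have h := sum_monoidHom_apply (unitsEmb F E a)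
    have hiff : unitsEmb F E a = 1 ↔ a = 1 := by
      rw [← (unitsEmb_injective F (E := E)).eq_iff, map_one]
    simpa only [hiff, apply_unitsEmb] using h
  -- By orthogonality in the dual groups, `R` vanishes off the identity, where it equals the order
  -- of the group.
  have hRv : HasValues b R (fun a => if a = 1 then
      ((Nat.card F : ℂ) ^ 2 - 1) * ((Nat.card F : ℂ) ^ 2 - Nat.card F) else 0) (fun _ => 0)
      (fun _ _ => 0) (fun _ => 0) := by
    constructor
    · intro a
      rw [hRapp]
      have h1 : ∑ α : Fˣ →* ℂˣ, ∑ β : Fˣ →* ℂˣ, ((Nat.card F : ℂ) + 1) * ((α a) * (β a)) =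
          ((Nat.card F : ℂ) + 1) * ∑ α : Fˣ →* ℂˣ, ∑ β : Fˣ →* ℂˣ, (α a : ℂ) * (β a) := by
        simp only [Finset.mul_sum]
      simp only [(hasValues_psFun b _ _).central_eq, (hasValues_cuspFun b _).central_eq]
      rw [h1, hprod, ← Finset.mul_sum, hres, natCard_units_eq F, natCard_ext_units_eq b]
      split_ifs <;> ring
    · intro a
      rw [hRapp]
      simp only [(hasValues_psFun b _ _).jordan_eq, (hasValues_cuspFun b _).jordan_eq,
        Finset.sum_neg_distrib, hprod, hres, natCard_units_eq F, natCard_ext_units_eq b]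
      split_ifs <;> ring
    · intro a d had
      rw [hRapp]
      simp only [(hasValues_psFun b _ _).split_eq a d had, (hasValues_cuspFun b _).split_eq a d had,
        Finset.sum_add_distrib, hprod, Finset.sum_const_zero]
      by_cases ha : a = 1
      · rw [if_neg (fun h => had (ha.trans h.symm) : ¬ d = 1)]
        ring
      · rw [if_neg ha]
        ring
    · intro z hz
      rw [hRapp]
      have hz1 : z ≠ 1 := by
        rintro rfl
        exact hz ⟨1, by simp⟩
      have hz2 : z ^ Nat.card F ≠ 1 := by
        intro h
        refine hz ((pow_card_mem_range_iff b).1 ⟨1, ?_⟩)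
        rw [← Units.val_pow_eq_pow_val, h, map_one, Units.val_one]
      simp only [(hasValues_psFun b _ _).elliptic_eq z hz,
        (hasValues_cuspFun b _).elliptic_eq z hz, Finset.sum_neg_distrib, Finset.sum_add_distrib,
        MonoidHom.pow_apply, ← map_pow, sum_monoidHom_apply, if_neg hz1, if_neg hz2,
        Finset.sum_const_zero]
      ring
  have hsum : ((Nat.card F : ℂ) + 1) / 2 * ∑ α : Fˣ →* ℂˣ, ∑ β : Fˣ →* ℂˣ, pairing (psFun α β) χ +
      ((Nat.card F : ℂ) - 1) / 2 * ∑ Λ : Eˣ →* ℂˣ, pairing (cuspFun b Λ) χ = pairing R χ := by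
    simp only [hR, pairing_add_left, pairing_smul_left, pairing_sum_left]
  rw [hsum]
  apply mul_left_cancel₀ (natCard_GL_ne_zero F)
  rw [natCard_mul_pairing b hRc hχ hRv hvχ]
  simp only [zero_mul, Finset.sum_const_zero, mul_zero, sub_zero, add_zero, ite_mul,
    Finset.sum_ite_eq', Finset.mem_univ, if_true, inv_one, upper_one_one_zero]

/-- Every irreducible representation of `GL(2, F)` belongs to one of the four families. -/
theorem exists_of_isIrreducible {V : Type*} [AddCommGroup V] [Module ℂ V] [FiniteDimensional ℂ V]
    (π : Representation ℂ (GL (Fin 2) F) V) (hπ : π.IsIrreducible) :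
    (∃ α : Fˣ →* ℂˣ, IsOneDim b α π) ∨ (∃ α : Fˣ →* ℂˣ, IsSteinberg b α π) ∨
      (∃ α β : Fˣ →* ℂˣ, α ≠ β ∧ IsPrincipal b α β π) ∨
      (∃ Λ : Eˣ →* ℂˣ, Λ ≠ Λ ^ Nat.card F ∧ IsCuspidal b Λ π) := by
  by_contra! hcon
  obtain ⟨h1, h2, h3, h4⟩ := hcon
  have z1 : ∀ α : Fˣ →* ℂˣ, pairing (detFun α) π.character = 0 := by
    intro α
    by_contra hne
    obtain ⟨ρ, hρ, hρχ⟩ := exists_isOneDim b α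
    have := hρ.irreducible
    rw [← hρχ] at hne
    exact h1 α ⟨hπ, character_eq_of_pairing_ne_zero ρ π hne ▸ hρ.values⟩
  have z2 : ∀ α : Fˣ →* ℂˣ, pairing (psFun α α - detFun α) π.character = 0 := by
    intro α
    by_contra hne
    obtain ⟨ρ, hρ, hρχ⟩ := exists_isSteinberg b α
    have := hρ.irreducible
    rw [← hρχ] at hne
    exact h2 α ⟨hπ, character_eq_of_pairing_ne_zero ρ π hne ▸ hρ.values⟩
  have z3 : ∀ α β : Fˣ →* ℂˣ, pairing (psFun α β) π.character = 0 := by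
    intro α β
    by_cases hαβ : α = β
    · subst hαβ
      have := z2 α
      rwa [pairing_sub_left, z1, sub_zero] at this
    · by_contra hne
      obtain ⟨ρ, hρ, hρχ⟩ := exists_isPrincipal b hαβ
      have := hρ.irreducible
      rw [← hρχ] at hne
      exact h3 α β hαβ ⟨hπ, character_eq_of_pairing_ne_zero ρ π hne ▸ hρ.values⟩
  have z4 : ∀ Λ : Eˣ →* ℂˣ, pairing (cuspFun b Λ) π.character = 0 := by
    intro Λ
    by_cases hΛ : Λ = Λ ^ Nat.card F
    · obtain ⟨α, hα⟩ := exists_eq_compNorm_of_eq_pow_card b hΛ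
      -- In the degenerate case the virtual character is Steinberg minus `α ∘ det`, both of which
      -- are already known to be orthogonal to `π`.
      have heq : cuspFun b Λ = psFun α α - detFun α - detFun α := by
        have v1 := hasValues_cuspFun b Λ
        have v2 := hasValues_steinberg b α
        have v3 := hasValues_detFun b α
        have hr : ∀ a : Fˣ, (res F Λ a : ℂ) = (α a : ℂ) ^ 2 := fun a => by
          rw [← apply_unitsEmb, hα, compNorm_unitsEmb b, Units.val_pow_eq_pow_val]
        refine ext_of_hasValues b (isClassFun_cuspFun b Λ)
          (((isCharacter_psFun α α).isClassFun.sub (isCharacter_detFun α).isClassFun).sub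
            (isCharacter_detFun α).isClassFun) v1 ⟨fun a => ?_, fun a => ?_, fun a d had => ?_,
            fun z hz => ?_⟩
        · rw [Pi.sub_apply, v2.central_eq, v3.central_eq, hr]
          ring
        · rw [Pi.sub_apply, v2.jordan_eq, v3.jordan_eq, hr]
          ring
        · rw [Pi.sub_apply, v2.split_eq a d had, v3.split_eq a d had, sub_self]
        · rw [Pi.sub_apply, v2.elliptic_eq z hz, v3.elliptic_eq z hz, ← hΛ, ← hα]
          ring
      rw [heq, pairing_sub_left, z1, z2, sub_zero]
    · by_contra hne
      obtain ⟨ρ, hρ, hρχ⟩ := exists_isCuspidal b hΛ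
      have := hρ.irreducible
      rw [← hρχ] at hne
      exact h4 Λ hΛ ⟨hπ, character_eq_of_pairing_ne_zero ρ π hne ▸ hρ.values⟩
  have : Fintype (Fˣ →* ℂˣ) := Fintype.ofFinite _
  have : Fintype (Eˣ →* ℂˣ) := Fintype.ofFinite _
  -- All terms on the left vanish, so the degree of `π` is zero, which an irreducible representation
  -- excludes.
  have key := pairing_regular b (isCharacter_character π).isClassFun
  simp only [z3, z4, Finset.sum_const_zero, mul_zero, add_zero] at key
  rw [Representation.char_one, eq_comm, Nat.cast_eq_zero, Module.finrank_zero_iff] at key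
  exact bot_ne_top (α := Subrepresentation π) (Subrepresentation.toSubmodule_injective
    (Subsingleton.elim _ _))

end Completeness

end GL2Torus
end

theorem mainTheorem2 {F : Type u} {E : Type v} [Field F] [Finite F] [Field E] [Algebra F E]
    (b : Module.Basis (Fin 2) F E) :
    -- each of the parameters is attached to an irreducible representation of dimension `d`
    (∀ α : Fˣ →* ℂˣ, ∃ π : Representation ℂ (GL (Fin 2) F) (Fin 1 → ℂ),
      GL2Torus.IsOneDim b α π) ∧
    (∀ α : Fˣ →* ℂˣ, ∃ π : Representation ℂ (GL (Fin 2) F) (Fin (Nat.card F) → ℂ),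
      GL2Torus.IsSteinberg b α π) ∧
    (∀ α β : Fˣ →* ℂˣ, α ≠ β →
      ∃ π : Representation ℂ (GL (Fin 2) F) (Fin (Nat.card F + 1) → ℂ),
        GL2Torus.IsPrincipal b α β π) ∧
    (∀ Λ : Eˣ →* ℂˣ, Λ ≠ Λ ^ Nat.card F →
      ∃ π : Representation ℂ (GL (Fin 2) F) (Fin (Nat.card F - 1) → ℂ),
        GL2Torus.IsCuspidal b Λ π) ∧
    -- every irreducible representation is one of these, and its multiplicity is as in the table
    (∀ (V : Type w) [AddCommGroup V] [Module ℂ V] [FiniteDimensional ℂ V]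
      (π : Representation ℂ (GL (Fin 2) F) V),
      (π.IsIrreducible →
        (∃ α : Fˣ →* ℂˣ, GL2Torus.IsOneDim b α π) ∨
        (∃ α : Fˣ →* ℂˣ, GL2Torus.IsSteinberg b α π) ∨
        (∃ α β : Fˣ →* ℂˣ, α ≠ β ∧ GL2Torus.IsPrincipal b α β π) ∨
        (∃ Λ : Eˣ →* ℂˣ, Λ ≠ Λ ^ Nat.card F ∧ GL2Torus.IsCuspidal b Λ π)) ∧
      ∀ Φ : Eˣ →* ℂˣ,
        (∀ α : Fˣ →* ℂˣ, GL2Torus.IsOneDim b α π →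
          (GL2Torus.mult π (GL2Torus.indTorus b Φ) : ℤ) =
            GL2Torus.delta (GL2Torus.compNorm E α) Φ) ∧
        (∀ α : Fˣ →* ℂˣ, GL2Torus.IsSteinberg b α π →
          (GL2Torus.mult π (GL2Torus.indTorus b Φ) : ℤ) =
            GL2Torus.delta (α ^ 2) (GL2Torus.res F Φ) -
              GL2Torus.delta (GL2Torus.compNorm E α) Φ) ∧
        (∀ α β : Fˣ →* ℂˣ, α ≠ β → GL2Torus.IsPrincipal b α β π →
          (GL2Torus.mult π (GL2Torus.indTorus b Φ) : ℤ) =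
            GL2Torus.delta (α * β) (GL2Torus.res F Φ)) ∧
        (∀ Λ : Eˣ →* ℂˣ, Λ ≠ Λ ^ Nat.card F → GL2Torus.IsCuspidal b Λ π →
          (GL2Torus.mult π (GL2Torus.indTorus b Φ) : ℤ) =
            GL2Torus.delta (GL2Torus.res F Λ) (GL2Torus.res F Φ) -
              GL2Torus.delta Λ Φ - GL2Torus.delta (Λ ^ Nat.card F) Φ)) := by
  have : Fintype F := Fintype.ofFinite F
  have := Module.Finite.of_basis b
  have : Finite E := Module.finite_of_finite F
  have : Fintype E := Fintype.ofFinite E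
  refine ⟨fun α => ?_, fun α => ?_, fun α β hαβ => ?_, fun Λ hΛ => ?_, ?_⟩
  · obtain ⟨π, hπ, -⟩ := GL2Torus.exists_isOneDim b α
    exact ⟨π, hπ⟩
  · obtain ⟨π, hπ, -⟩ := GL2Torus.exists_isSteinberg b α
    exact ⟨π, hπ⟩
  · obtain ⟨π, hπ, -⟩ := GL2Torus.exists_isPrincipal b hαβ
    exact ⟨π, hπ⟩
  · obtain ⟨π, hπ, -⟩ := GL2Torus.exists_isCuspidal b hΛ
    exact ⟨π, hπ⟩
  · intro V _ _ _ π
    exact ⟨GL2Torus.exists_of_isIrreducible b π, fun Φ =>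
      ⟨fun α h => GL2Torus.mult_of_isOneDim b h Φ, fun α h => GL2Torus.mult_of_isSteinberg b h Φ,
        fun α β _ h => GL2Torus.mult_of_isPrincipal b h Φ,
        fun Λ _ h => GL2Torus.mult_of_isCuspidal b h Φ⟩⟩
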